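/- For integers $n\ge 1$ and $0\le k\le n$, the $(n,k)$-Bernoulli–Laplace chain has two urns with $n$ balls each; of the $2n$ balls, $n$ are red and $n$ are white. At each step, $k$ balls are chosen from each urn, uniformly without replacement and independently for the two urns, and the two chosen sets are swapped. The state $X_t\in\{0,\dots,n\}$ is the number of red balls in the left urn after $t$ steps. Let $p_t(x,y)$ be the $t$-step transition probabilities and $\pi(x)=\binom nx\binom n{n-x}/\binom{2n}n$ the stationary distribution, and put $$d^{(n)}(t)=\tfrac12\max_x\sum_y|p_t(x,y)-\pi(y)|,\qquad t_{\rm mix}^{(n)}(\epsilon)=\min\{t\in\{0,1,2,\dots\}: d^{(n)}(t)\le\epsilon\}.$$ Let $\lambda\in(0,1/2)$, let $n_0\in\mathbb N$, and let $k=k(n)$ be a sequence such that $k/n\to\lambda$ as $n\to\infty$; for some $\delta\in(0,1/2)$ one has $k/n\in(0,\delta)$ for all $n\ge n_0$ (so necessarily $n_0\ge 3$); and $k/n-\lambda=o(1/\log n)$. Put $$t_n=\frac{\log n}{2|\log(1-2\lambda)|},\qquad s_n=\lambda^{-1}\log\log n .$$ **Theorem 1.** (a) For every $\epsilon\in(0,1)$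 there are a constant $c(\epsilon)>0$, depending only on $\epsilon$ and $\lambda$, and an integer $N(\epsilon)>0$, depending only on $\epsilon$ and the sequence $k(n)$, such that $$t_n-c(\epsilon)\le t_{\rm mix}^{(n)}(\epsilon)\le t_n+3s_n+1\qquad\text{for all } n\ge N(\epsilon).$$ (b) In particular, the chain has cutoff at $t_n$ with window $s_n$. That is, for $n\ge n_0$ and $\epsilon\in(0,1)$ the minimum defining $t_{\rm mix}^{(n)}(\epsilon)$ exists. For every $\epsilon\in(0,1)$, $$t_{\rm mix}^{(n)}(\epsilon)/t_n\to1\quad\text{and}\quad t_{\rm mix}^{(n)}(\epsilon)/t_{\rm mix}^{(n)}(1-\epsilon)\to1\qquad\text{as } n\to\infty .$$ Moreover $s_n=o(t_{\rm mix}^{(n)}(1/2))$, and for every $\epsilon\in(0,1)$ there is a constant $C_\epsilon$ with $t_{\rm mix}^{(n)}(\epsilon)-t_{\rm mix}^{(n)}(1-\epsilon)\le C_\epsilon s_n$ for all $n\ge n_0$. -/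

import Mathlib

open Filter Topology Asymptotics

noncomputable section

namespace BernoulliLaplace

/-- Each urn holds `n` balls, labelled by `Fin n` so that the red balls come first.  If the urn
holds `r` red balls, this is the number of red balls in the set `S` of selected balls. -/
def redSelected {n : ℕ} (r : ℕ) (S : Finset (Fin n)) : ℕ :=
  (S.filter fun b : Fin n => (b : ℕ) < r).card

/-- The pairs `(A, B)` of `k`-subsets, `A` of the left urn and `B` of the right urn. -/
def selections (n k : ℕ) : Finset (Finset (Fin n) × Finset (Fin n)) :=
  Finset.powersetCard k Finset.univ ×ˢ Finset.powersetCard k Finset.univ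

/-- One-step transition matrix of the `(n, k)`-Bernoulli-Laplace chain on `{0, …, n}`, which counts
the red balls in the left urn.  When the left urn has `x` red balls, the right urn has `n - x`.
Independent uniform `k`-subsets `A` (left) and `B` (right) are swapped, so that the new state `y`
is `x - (red balls in A) + (red balls in B)`. -/
def transition (n k : ℕ) : Matrix (Fin (n + 1)) (Fin (n + 1)) ℝ := fun x y =>
  (((selections n k).filter fun AB =>
      (x : ℕ) + redSelected (n - (x : ℕ)) AB.2 = (y : ℕ) + redSelected (x : ℕ) AB.1).card : ℝ) /
    ((selections n k).card : ℝ)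

/-- The `t`-step transition probability `p_t(x, y)`. -/
def transitionProb (n k t : ℕ) (x y : Fin (n + 1)) : ℝ := (transition n k ^ t) x y

/-- The hypergeometric stationary distribution. -/
def stationary (n : ℕ) (x : Fin (n + 1)) : ℝ :=
  (n.choose (x : ℕ) : ℝ) * (n.choose (n - (x : ℕ)) : ℝ) / ((2 * n).choose n : ℝ)

/-- Total variation distance between two mass functions on a finite set. -/
def tvDist {X : Type*} [Fintype X] (μ ν : X → ℝ) : ℝ := (1 / 2) * ∑ y, |μ y - ν y|

/-- The maximal distance to stationarity after `t` steps over all starting states. -/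
def distToStationary (n k t : ℕ) : ℝ :=
  Finset.univ.sup' Finset.univ_nonempty fun x : Fin (n + 1) =>
    tvDist (transitionProb n k t x) (stationary n)

/-- The mixing time `min {t | d(t) ≤ ε}`. -/
def mixingTime (n k : ℕ) (ε : ℝ) : ℕ := sInf {t : ℕ | distToStationary n k t ≤ ε}

/-- `t_n = log n / (2 |log (1 - 2 λ)|)`. -/
def cutoffTime (lam : ℝ) (n : ℕ) : ℝ := Real.log n / (2 * |Real.log (1 - 2 * lam)|)

/-- `s_n = λ⁻¹ log log n`. -/
def windowSize (lam : ℝ) (n : ℕ) : ℝ := lam⁻¹ * Real.log (Real.log n)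

/-- The conditions on the numbers `k n` of balls swapped in the models with `n ≥ n₀` balls per urn.
The values `k n` for `n < n₀` play no role; the condition `bounded` forces `3 ≤ n₀`. -/
structure SwapAssumption (k : ℕ → ℕ) (lam : ℝ) (n₀ : ℕ) : Prop where
  lam_mem : lam ∈ Set.Ioo (0 : ℝ) (1 / 2)
  tendsto : Tendsto (fun n => (k n : ℝ) / n) atTop (𝓝 lam)
  bounded : ∃ δ ∈ Set.Ioo (0 : ℝ) (1 / 2), ∀ n ≥ n₀, (k n : ℝ) / n ∈ Set.Ioo (0 : ℝ) δ
  rate : (fun n => (k n : ℝ) / n - lam) =o[atTop] (fun n : ℕ => 1 / Real.log n)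

/-- Cutoff for a sequence of chains with mixing times `tmix n ε`. -/
def HasCutoff (tmix : ℕ → ℝ → ℕ) : Prop :=
  ∀ ε ∈ Set.Ioo (0 : ℝ) 1,
    Tendsto (fun n => (tmix n ε : ℝ) / (tmix n (1 - ε) : ℝ)) atTop (𝓝 1)

/-- Cutoff with window `w n`, for a sequence of chains indexed by `n ≥ n₀`. -/
def HasCutoffWindow (n₀ : ℕ) (tmix : ℕ → ℝ → ℕ) (w : ℕ → ℝ) : Prop :=
  HasCutoff tmix ∧
  w =o[atTop] (fun n => (tmix n (1 / 2) : ℝ)) ∧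
  ∀ ε ∈ Set.Ioo (0 : ℝ) 1, ∃ C : ℝ, ∀ n ≥ n₀,
    (tmix n ε : ℝ) - (tmix n (1 - ε) : ℝ) ≤ C * w n

end BernoulliLaplace

end

/-!
Write `p = k / n` and let `φ y = y - n / 2`.

*Lower bound.* The function `φ` is an eigenfunction of the chain with eigenvalue `1 - 2 p`, and the
second moment of `φ` relaxes to order `n`. Started from `n`, the mean of `φ` after `t` steps is
`(1 - 2 p) ^ t * n / 2`, which at time `t_n - c` is a large multiple of `√n`, while the standard
deviations of the state and of the stationary distribution are of order `√n`. Chebyshev's inequality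
then separates the two (`one_sub_le_distToStationary`). The hypothesis `p - λ = o(1 / log n)` gives
`n (1 - 2 p) ^ (2 t_n) → 1` (`SwapAssumption.tendsto_log_add`).

*Upper bound.* Functions on the state space are followed under the expectation operator `step`.
* One step maps a function bounded by one to a function whose Lipschitz constant on
  `[n / 4, 3 n / 4]` is of order `n ^ (-1/2)` (`abs_step_succ_sub_le_of_abs_le_one`). This rests on
  the exact formula for the effect of recolouring one ball on a hypergeometric distribution: the
  difference has density proportional to the deviation of the selection from its mean in an urn
  with one ball more (`abs_hyp_recolour_le`, `abs_hyp_recolour_shift_le`), so that no local limit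
  theorem is needed.
* One step contracts Lipschitz constants by `(1 - p) ^ 2 + p ^ 2 < 1`, by coupling the selections
  (`abs_step_succ_sub_le`); about `2 s_n` steps make the constant small compared with `n ^ (-1/2)`.
* After `t_n` steps the state is within order `√n` of `n / 2`, by the second moment of `φ`.

Together these show that the expectation of any function bounded by one after about `t_n + 3 s_n`
steps depends little on the starting point (`distToStationary_add_le`). The stationary distribution
enters only through its invariance, which follows from reversibility (`stationary_mul_transition`).
-/

noncomputable section

namespace BernoulliLaplace

/-! ### The hypergeometric distribution -/

/-- The sum of `g i j` over all selections of `k` balls from `r` red and `w` white balls, where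
`i` and `j` are the numbers of red and of white balls selected. -/
def hypSum (r w k : ℕ) (g : ℕ → ℕ → ℝ) : ℝ :=
  ∑ ij ∈ Finset.HasAntidiagonal.antidiagonal k,
    (r.choose ij.1 : ℝ) * (w.choose ij.2 : ℝ) * g ij.1 ij.2

/-- The expectation of `g` of the number of red balls among `k` balls drawn without replacement
from `r` red and `w` white ones.  It is `0` if there are fewer than `k` balls. -/
def hyp (r w k : ℕ) (g : ℕ → ℝ) : ℝ :=
  hypSum r w k (fun i _ => g i) / ((r + w).choose k : ℝ)

lemma hypSum_congr {r w k : ℕ} {g g' : ℕ → ℕ → ℝ}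
    (h : ∀ i j, i ≤ r → i + j = k → g i j = g' i j) : hypSum r w k g = hypSum r w k g' := by
  refine Finset.sum_congr rfl fun ij hij => ?_
  rw [Finset.HasAntidiagonal.mem_antidiagonal] at hij
  by_cases hi : ij.1 ≤ r
  · rw [h _ _ hi hij]
  · rw [Nat.choose_eq_zero_of_lt (not_le.mp hi)]; simp

lemma hypSum_mono {r w k : ℕ} {g g' : ℕ → ℕ → ℝ} (h : ∀ i j, i ≤ r → g i j ≤ g' i j) :
    hypSum r w k g ≤ hypSum r w k g' := by
  refine Finset.sum_le_sum fun ij _ => ?_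
  by_cases hi : ij.1 ≤ r
  · exact mul_le_mul_of_nonneg_left (h _ _ hi) (by positivity)
  · rw [Nat.choose_eq_zero_of_lt (not_le.mp hi)]; simp

lemma hypSum_add (r w k : ℕ) (g g' : ℕ → ℕ → ℝ) :
    hypSum r w k (fun i j => g i j + g' i j) = hypSum r w k g + hypSum r w k g' := by
  simp only [hypSum, mul_add, Finset.sum_add_distrib]

lemma hypSum_const_mul (r w k : ℕ) (c : ℝ) (g : ℕ → ℕ → ℝ) :
    hypSum r w k (fun i j => c * g i j) = c * hypSum r w k g := by
  simp only [hypSum, Finset.mul_sum]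
  exact Finset.sum_congr rfl fun _ _ => by ring

lemma hypSum_sub (r w k : ℕ) (g g' : ℕ → ℕ → ℝ) :
    hypSum r w k (fun i j => g i j - g' i j) = hypSum r w k g - hypSum r w k g' := by
  simp only [hypSum, mul_sub, Finset.sum_sub_distrib]

/-- Vandermonde's identity. -/
lemma hypSum_one (r w k : ℕ) : hypSum r w k (fun _ _ => 1) = ((r + w).choose k : ℝ) := by
  rw [Nat.add_choose_eq]
  simp [hypSum]

/-- Size-biasing by the number of red balls. -/
lemma hypSum_red_mul (r w k : ℕ) (g : ℕ → ℕ → ℝ) :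
    hypSum (r + 1) w (k + 1) (fun i j => i * g i j) =
      (r + 1) * hypSum r w k (fun i j => g (i + 1) j) := by
  simp only [hypSum, Finset.Nat.antidiagonal_succ, Finset.sum_cons, Finset.sum_map,
    Finset.mul_sum]
  simp only [Nat.cast_zero, zero_mul, mul_zero, zero_add]
  refine Finset.sum_congr rfl fun ij _ => ?_
  have h : ((r : ℝ) + 1) * (r.choose ij.1) = ((r + 1).choose (ij.1 + 1)) * ((ij.1 : ℝ) + 1) := by
    exact_mod_cast Nat.add_one_mul_choose_eq r ij.1
  simp only [Function.Embedding.prodMap, Function.Embedding.coeFn_mk, Prod.map,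
    Function.Embedding.refl_apply, Nat.succ_eq_add_one, Nat.cast_add, Nat.cast_one]
  linear_combination -(w.choose ij.2 : ℝ) * g (ij.1 + 1) ij.2 * h

lemma hypSum_swap (r w k : ℕ) (g : ℕ → ℕ → ℝ) :
    hypSum r w k g = hypSum w r k (fun i j => g j i) := by
  unfold hypSum
  conv_lhs => rw [← Finset.HasAntidiagonal.map_swap_antidiagonal, Finset.sum_map]
  exact Finset.sum_congr rfl fun ij _ => by
    simp only [Function.Embedding.coeFn_mk, Prod.fst_swap, Prod.snd_swap]; ring

/-- Size-biasing by the number of white balls. -/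
lemma hypSum_white_mul (r w k : ℕ) (g : ℕ → ℕ → ℝ) :
    hypSum r (w + 1) (k + 1) (fun i j => j * g i j) =
      (w + 1) * hypSum r w k (fun i j => g i (j + 1)) := by
  rw [hypSum_swap, hypSum_red_mul w r k (fun i j => g j i), hypSum_swap]

/-- Conditioning on whether a distinguished red ball is selected. -/
lemma hypSum_red_succ (r w k : ℕ) (g : ℕ → ℕ → ℝ) :
    hypSum (r + 1) w (k + 1) g =
      hypSum r w (k + 1) g + hypSum r w k (fun i j => g (i + 1) j) := by
  simp only [hypSum, Finset.Nat.antidiagonal_succ, Finset.sum_cons, Finset.sum_map]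
  rw [add_assoc, ← Finset.sum_add_distrib]
  congr 1
  · simp
  · refine Finset.sum_congr rfl fun ij _ => ?_
    simp only [Function.Embedding.prodMap, Function.Embedding.coeFn_mk, Prod.map,
      Function.Embedding.refl_apply, Nat.succ_eq_add_one, Nat.choose_succ_succ' r, Nat.cast_add]
    ring

/-- Conditioning on whether a distinguished white ball is selected. -/
lemma hypSum_white_succ (r w k : ℕ) (g : ℕ → ℕ → ℝ) :
    hypSum r (w + 1) (k + 1) g =
      hypSum r w (k + 1) g + hypSum r w k (fun i j => g i (j + 1)) := by
  rw [hypSum_swap, hypSum_red_succ, ← hypSum_swap r w (k + 1), hypSum_swap r w k]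

lemma hyp_congr {r w k : ℕ} {g g' : ℕ → ℝ} (h : ∀ i ≤ r, g i = g' i) :
    hyp r w k g = hyp r w k g' := by
  unfold hyp
  rw [hypSum_congr fun i _ hi _ => h i hi]

lemma hyp_mono {r w k : ℕ} {g g' : ℕ → ℝ} (h : ∀ i ≤ r, g i ≤ g' i) :
    hyp r w k g ≤ hyp r w k g' := by
  unfold hyp
  gcongr
  exact hypSum_mono fun i _ hi => h i hi

lemma hyp_add (r w k : ℕ) (g g' : ℕ → ℝ) :
    hyp r w k (fun i => g i + g' i) = hyp r w k g + hyp r w k g' := by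
  simp only [hyp, hypSum_add, add_div]

lemma hyp_sub (r w k : ℕ) (g g' : ℕ → ℝ) :
    hyp r w k (fun i => g i - g' i) = hyp r w k g - hyp r w k g' := by
  simp only [hyp, hypSum_sub, sub_div]

lemma hyp_const_mul (r w k : ℕ) (c : ℝ) (g : ℕ → ℝ) :
    hyp r w k (fun i => c * g i) = c * hyp r w k g := by
  simp only [hyp, hypSum_const_mul, mul_div_assoc]

lemma hyp_const {r w k : ℕ} (hk : k ≤ r + w) (c : ℝ) : hyp r w k (fun _ => c) = c := by
  have h := hyp_const_mul r w k c fun _ => 1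
  have h0 : ((r + w).choose k : ℝ) ≠ 0 := by exact_mod_cast (Nat.choose_pos hk).ne'
  have h1 : hyp r w k (fun _ => (1 : ℝ)) = 1 := by rw [hyp, hypSum_one, div_self h0]
  simpa [h1] using h

lemma abs_hyp_le (r w k : ℕ) {g : ℕ → ℝ} {c : ℝ} (hc : 0 ≤ c) (h : ∀ i ≤ r, |g i| ≤ c) :
    |hyp r w k g| ≤ c := by
  have h1 : hyp r w k (fun _ => c) ≤ c := by
    by_cases hk : k ≤ r + w
    · exact (hyp_const hk c).le
    · simpa [hyp, Nat.choose_eq_zero_of_lt (not_le.mp hk)] using hc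
  have h2 : hyp r w k (fun _ => -c) = -hyp r w k (fun _ => c) := by
    simpa using hyp_const_mul r w k (-1) fun _ => c
  rw [abs_le]
  constructor
  · exact le_trans (by linarith) (hyp_mono (g := fun _ => -c) fun i hi => (abs_le.mp (h i hi)).1)
  · exact (hyp_mono fun i hi => (abs_le.mp (h i hi)).2).trans h1

lemma hyp_mul_self (r w k : ℕ) (g : ℕ → ℝ) :
    hyp (r + 1) w (k + 1) (fun i => i * g i) =
      (r + 1) * (k + 1) / (r + w + 1) * hyp r w k (fun i => g (i + 1)) := by
  unfold hyp
  rw [hypSum_red_mul r w k fun i _ => g i]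
  have h : ((r : ℝ) + w + 1) * ((r + w).choose k) =
      ((r + 1 + w).choose (k + 1)) * ((k : ℝ) + 1) := by
    rw [show r + 1 + w = r + w + 1 by ring]
    exact_mod_cast Nat.add_one_mul_choose_eq (r + w) k
  have h0 : (r : ℝ) + w + 1 ≠ 0 := by positivity
  have h1 : (k : ℝ) + 1 ≠ 0 := by positivity
  by_cases hc : ((r + w).choose k : ℝ) = 0
  · have : ((r + 1 + w).choose (k + 1) : ℝ) = 0 := by
      rw [hc, mul_zero] at h
      exact (mul_eq_zero.mp h.symm).resolve_right h1
    simp [hc, this]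
  · have hc' : ((r + 1 + w).choose (k + 1) : ℝ) ≠ 0 := by
      intro h2
      rw [h2, zero_mul] at h
      exact (mul_ne_zero h0 hc) h
    rw [div_mul_div_comm, div_eq_div_iff hc' (mul_ne_zero h0 hc)]
    linear_combination ((r : ℝ) + 1) * hypSum r w k (fun i _ => g (i + 1)) * h

/-- The mean of the hypergeometric distribution. -/
lemma hyp_mean {r w k : ℕ} (hk : k ≤ r + w) :
    hyp r w k (fun i => (i : ℝ)) = r * k / (r + w) := by
  rcases r with _ | r
  · rw [hyp_congr (g' := fun _ => 0) (by simp), hyp_const hk]; simp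
  rcases k with _ | k
  · simp [hyp, hypSum]
  · have := hyp_mul_self r w k fun _ => 1
    rw [hyp_const (by omega)] at this
    simp only [mul_one] at this
    rw [this]; push_cast; ring

/-- The variance of the hypergeometric distribution is at most its mean, because distinct balls are
selected with nonpositive correlation. -/
lemma hyp_sq_le {r w k : ℕ} (hk : k ≤ r + w) (c : ℝ) :
    hyp r w k (fun i => (c + i) ^ 2) ≤ (c + r * k / (r + w)) ^ 2 + r * k / (r + w) := by
  have key : hyp r w k (fun i => (i : ℝ) * (i - 1)) ≤ ((r : ℝ) * k / (r + w)) ^ 2 := by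
    rcases r with _ | r
    · rw [hyp_congr (g' := fun _ => 0) (by simp), hyp_const hk]; positivity
    rcases k with _ | k
    · simp [hyp, hypSum]
    have h := hyp_mul_self r w k fun i => (i : ℝ) - 1
    simp only [Nat.cast_add, Nat.cast_one, add_sub_cancel_right] at h
    rw [hyp_mean (by omega)] at h
    rw [h, sq]
    push_cast
    have hd : (0 : ℝ) < r + 1 + w := by positivity
    rw [show (r : ℝ) + w + 1 = r + 1 + w by ring]
    refine mul_le_mul_of_nonneg_left ?_ (by positivity)
    rcases (show 0 ≤ r + w by omega).eq_or_lt with h0 | h0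
    · have : r = 0 := by omega
      subst this
      simp; positivity
    · have h0' : (0 : ℝ) < r + w := by exact_mod_cast h0
      rw [div_le_div_iff₀ h0' hd]
      have hk' : (k : ℝ) ≤ r + w := by exact_mod_cast (by omega : k ≤ r + w)
      have hk0 : (0 : ℝ) ≤ k := by positivity
      have hr0 : (0 : ℝ) ≤ r := by positivity
      have hw0 : (0 : ℝ) ≤ w := by positivity
      nlinarith [mul_nonneg hr0 hk0, mul_nonneg hr0 hr0, mul_nonneg hr0 hw0, mul_nonneg hk0 hw0]
  have e : hyp r w k (fun i => (c + i) ^ 2) =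
      c ^ 2 + (2 * c + 1) * hyp r w k (fun i => (i : ℝ)) +
        hyp r w k (fun i => (i : ℝ) * (i - 1)) := by
    rw [← hyp_const hk (c ^ 2), ← hyp_const_mul, ← hyp_add, ← hyp_add]
    exact hyp_congr fun i _ => by ring
  rw [e, hyp_mean hk]
  nlinarith

/-- The mean absolute deviation is at most `√N` where `N` is the number of balls. -/
lemma hyp_abs_sub_mean_le {r w k : ℕ} (hk : k ≤ r + w) (hN : 0 < r + w) :
    hyp r w k (fun i => |(i : ℝ) - r * k / (r + w)|) ≤ √(r + w) := by
  have hN' : (0 : ℝ) < r + w := by exact_mod_cast hN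
  have hs : 0 < √((r : ℝ) + w) := Real.sqrt_pos.mpr hN'
  have hss : √((r : ℝ) + w) * √((r : ℝ) + w) = r + w := Real.mul_self_sqrt hN'.le
  set s := √((r : ℝ) + w)
  set m := (r : ℝ) * k / (r + w) with hm
  have hmN : m ≤ s * s := by
    rw [hm, hss, div_le_iff₀ hN']
    have : (k : ℝ) ≤ r + w := by exact_mod_cast hk
    have : (0 : ℝ) ≤ r := by positivity
    have : (0 : ℝ) ≤ w := by positivity
    have : (0 : ℝ) ≤ k := by positivity
    exact mul_le_mul (by linarith) (by assumption) (by positivity) hN'.le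
  have h1 : hyp r w k (fun i => |(i : ℝ) - m|) ≤
      hyp r w k (fun i => (2 * s)⁻¹ * (-m + i) ^ 2 + s / 2) := by
    refine hyp_mono fun i _ => ?_
    have : (2 * s)⁻¹ * (-m + i) ^ 2 + s / 2 - |(i : ℝ) - m| =
        (2 * s)⁻¹ * (|(i : ℝ) - m| - s) ^ 2 := by
      field_simp
      rw [sub_sq, sq_abs]
      ring
    have : 0 ≤ (2 * s)⁻¹ * (|(i : ℝ) - m| - s) ^ 2 := by positivity
    linarith
  refine h1.trans ?_
  rw [hyp_add, hyp_const_mul, hyp_const hk]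
  have h2 := hyp_sq_le hk (-m)
  rw [← hm, neg_add_cancel] at h2
  have h3 : (2 * s)⁻¹ * hyp r w k (fun i => (-m + i) ^ 2) ≤ (2 * s)⁻¹ * (s * s) :=
    mul_le_mul_of_nonneg_left (by nlinarith) (by positivity)
  have : (2 * s)⁻¹ * (s * s) = s / 2 := by field_simp
  linarith

/-- The probability that a distinguished ball is selected. -/
lemma choose_div_choose_succ {N k : ℕ} (hk : k ≤ N) :
    (N.choose k : ℝ) / (N + 1).choose (k + 1) = (k + 1) / (N + 1) := by
  have h : ((N : ℝ) + 1) * N.choose k = (N + 1).choose (k + 1) * ((k : ℝ) + 1) := by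
    exact_mod_cast Nat.add_one_mul_choose_eq N k
  have h0 : ((N + 1).choose (k + 1) : ℝ) ≠ 0 := by
    exact_mod_cast (Nat.choose_pos (by omega)).ne'
  rw [div_eq_div_iff h0 (by positivity)]
  linarith

lemma choose_succ_div_choose_succ {N k : ℕ} (hk : k ≤ N) :
    (N.choose (k + 1) : ℝ) / (N + 1).choose (k + 1) = 1 - (k + 1) / (N + 1) := by
  have h0 : ((N + 1).choose (k + 1) : ℝ) ≠ 0 := by
    exact_mod_cast (Nat.choose_pos (by omega)).ne'
  rw [← choose_div_choose_succ hk, eq_sub_iff_add_eq, ← add_div, div_eq_one_iff_eq h0]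
  rw [Nat.choose_succ_succ']
  push_cast
  ring

lemma hypSum_eq (r w k : ℕ) (g : ℕ → ℝ) :
    hypSum r w k (fun i _ => g i) = (r + w).choose k * hyp r w k g := by
  by_cases hk : k ≤ r + w
  · have h0 : ((r + w).choose k : ℝ) ≠ 0 := by exact_mod_cast (Nat.choose_pos hk).ne'
    rw [hyp, mul_div_cancel₀ _ h0]
  · have h0 : (r + w).choose k = 0 := Nat.choose_eq_zero_of_lt (not_le.mp hk)
    rw [h0, Nat.cast_zero, zero_mul]
    refine Finset.sum_eq_zero fun ij hij => ?_
    rw [Finset.HasAntidiagonal.mem_antidiagonal] at hij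
    rcases (by omega : r < ij.1 ∨ w < ij.2) with h | h
    · simp [Nat.choose_eq_zero_of_lt h]
    · simp [Nat.choose_eq_zero_of_lt h]

/-- Conditioning on whether a distinguished red ball is selected. -/
lemma hyp_red_succ {r w k : ℕ} (hk : k ≤ r + w) (g : ℕ → ℝ) :
    hyp (r + 1) w (k + 1) g =
      (1 - (k + 1) / (r + w + 1)) * hyp r w (k + 1) g +
        (k + 1) / (r + w + 1) * hyp r w k (fun i => g (i + 1)) := by
  have h1 := choose_div_choose_succ hk
  have h2 := choose_succ_div_choose_succ hk
  push_cast at h1 h2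
  rw [← h2, ← h1, hyp, hypSum_red_succ, hypSum_eq, hypSum_eq r w k fun i => g (i + 1),
    show r + 1 + w = r + w + 1 by ring]
  ring

/-- Conditioning on whether a distinguished white ball is selected. -/
lemma hyp_white_succ {r w k : ℕ} (hk : k ≤ r + w) (g : ℕ → ℝ) :
    hyp r (w + 1) (k + 1) g =
      (1 - (k + 1) / (r + w + 1)) * hyp r w (k + 1) g +
        (k + 1) / (r + w + 1) * hyp r w k g := by
  have h1 := choose_div_choose_succ hk
  have h2 := choose_succ_div_choose_succ hk
  push_cast at h1 h2
  rw [← h2, ← h1, hyp, hypSum_white_succ, hypSum_eq, hypSum_eq r w k g, ← add_assoc r w 1]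
  ring

/-- A weighted sum against the deviation of the composition of a selection from that of the urn is
small, as the number of red balls selected concentrates around its mean. -/
lemma abs_hypSum_mul_deviation_le {r w k : ℕ} (hk : k ≤ r + w + 2) {g : ℕ → ℝ}
    (hg : ∀ i, |g i| ≤ 1) :
    |hypSum (r + 1) (w + 1) k (fun i j => g i * (i / (r + 1) - j / (w + 1)))| ≤
      (r + w + 2).choose k * ((r + w + 2) * √(r + w + 2) / ((r + 1) * (w + 1))) := by
  set N : ℝ := r + w + 2 with hN
  set m : ℝ := (r + 1) * k / N with hm
  have hN0 : 0 < N := by positivity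
  have e : hypSum (r + 1) (w + 1) k (fun i j => g i * (i / (r + 1) - j / (w + 1))) =
      (r + w + 2).choose k *
        (N / ((r + 1) * (w + 1)) * hyp (r + 1) (w + 1) k (fun i => g i * (i - m))) := by
    have h := hypSum_eq (r + 1) (w + 1) k fun i => N / ((r + 1) * (w + 1)) * (g i * (i - m))
    rw [hyp_const_mul, show r + 1 + (w + 1) = r + w + 2 by ring] at h
    rw [← h]
    refine hypSum_congr fun i j _ hij => ?_
    have : (j : ℝ) = k - i := by rw [← hij]; push_cast; ring
    rw [this, hm]
    field_simp
    rw [hN]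
    ring
  rw [e, abs_mul, Nat.abs_cast]
  refine mul_le_mul_of_nonneg_left ?_ (by positivity)
  rw [abs_mul, abs_of_nonneg (by positivity), mul_div_right_comm]
  refine mul_le_mul_of_nonneg_left ?_ (by positivity)
  have h1 := hyp_abs_sub_mean_le (r := r + 1) (w := w + 1) (k := k) (by omega) (by omega)
  push_cast at h1
  rw [show (r : ℝ) + 1 + (w + 1) = N by rw [hN]; ring, ← hm] at h1
  have h2 : ∀ i : ℕ, |g i * (i - m)| ≤ |(i : ℝ) - m| := fun i => by
    rw [abs_mul]
    exact mul_le_of_le_one_left (abs_nonneg _) (hg i)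
  rw [abs_le]
  constructor
  · have h3 : hyp (r + 1) (w + 1) k (fun i => -1 * |(i : ℝ) - m|) ≤
        hyp (r + 1) (w + 1) k (fun i => g i * (i - m)) :=
      hyp_mono fun i _ => by linarith [(abs_le.mp (h2 i)).1]
    rw [hyp_const_mul] at h3
    linarith
  · exact (hyp_mono fun i _ => (abs_le.mp (h2 i)).2).trans h1

/-- Recolouring one of the balls changes the hypergeometric distribution little in total
variation. -/
lemma abs_hyp_recolour_le {r w k : ℕ} (hk : k ≤ r + w + 1) {g : ℕ → ℝ} (hg : ∀ i, |g i| ≤ 1) :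
    |hyp (r + 1) w k g - hyp r (w + 1) k g| ≤
      (r + w + 2) ^ 2 * √(r + w + 2) / ((r + w + 2 - k) * ((r + 1) * (w + 1))) := by
  have hc : (0 : ℝ) < (r + w + 1).choose k := by exact_mod_cast Nat.choose_pos hk
  have hk' : (k : ℝ) ≤ r + w + 1 := by exact_mod_cast hk
  have hd : (0 : ℝ) < r + w + 2 - k := by linarith
  have e : hypSum (r + 1) w k (fun i _ => g i) - hypSum r (w + 1) k (fun i _ => g i) =
      hypSum (r + 1) (w + 1) k (fun i j => g i * (i / (r + 1) - j / (w + 1))) := by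
    unfold hypSum
    rw [← Finset.sum_sub_distrib]
    refine Finset.sum_congr rfl fun ij _ => ?_
    have h (a b : ℕ) : (a.choose b : ℝ) = (a + 1).choose b * (1 - b / (a + 1)) := by
      by_cases hb : b ≤ a + 1
      · have := Nat.choose_mul_succ_eq a b
        have h1 : (a.choose b : ℝ) * (a + 1) = (a + 1).choose b * (a + 1 - b) := by
          rw [← Nat.cast_succ, ← Nat.cast_sub hb]; exact_mod_cast this
        field_simp
        linarith
      · rw [Nat.choose_eq_zero_of_lt (by omega), Nat.choose_eq_zero_of_lt (by omega)]; simp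
    rw [h w, h r]
    ring
  have hcc : ((r + w + 2).choose k : ℝ) / (r + w + 1).choose k =
      (r + w + 2) / (r + w + 2 - k) := by
    have := Nat.choose_mul_succ_eq (r + w + 1) k
    have h1 : ((r + w + 1).choose k : ℝ) * (r + w + 2) =
        (r + w + 2).choose k * (r + w + 2 - k) := by
      have h2 : (r : ℝ) + w + 2 - k = ((r + w + 1 + 1 - k : ℕ) : ℝ) := by
        rw [Nat.cast_sub (by omega)]; push_cast; ring
      rw [h2]; exact_mod_cast this
    rw [div_eq_div_iff hc.ne' hd.ne']
    linarith
  rw [hyp, hyp, show r + 1 + w = r + w + 1 by ring, ← add_assoc r w 1, ← sub_div, e, abs_div,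
    Nat.abs_cast]
  calc _ ≤ (r + w + 2).choose k * ((r + w + 2) * √(r + w + 2) / ((r + 1) * (w + 1))) /
        (r + w + 1).choose k := by
        gcongr
        exact abs_hypSum_mul_deviation_le (by omega) hg
    _ = (r + w + 2).choose k / (r + w + 1).choose k *
        ((r + w + 2) * √(r + w + 2) / ((r + 1) * (w + 1))) := by ring
    _ = _ := by
      rw [hcc, div_mul_div_comm]
      ring

/-- Recolouring one of the balls and shifting the count of red balls changes the hypergeometric
distribution little in total variation. -/
lemma abs_hyp_recolour_shift_le {r w k : ℕ} (hk : k ≤ r + w + 1) {g : ℕ → ℝ}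
    (hg : ∀ i, |g i| ≤ 1) :
    |hyp (r + 1) w k g - hyp r (w + 1) k (fun i => g (i + 1))| ≤
      (r + w + 2) ^ 2 * √(r + w + 2) / ((k + 1) * ((r + 1) * (w + 1))) := by
  have hc : (0 : ℝ) < (r + w + 1).choose k := by exact_mod_cast Nat.choose_pos hk
  have e : hypSum (r + 1) w k (fun i _ => g i) - hypSum r (w + 1) k (fun i _ => g (i + 1)) =
      -hypSum (r + 1) (w + 1) (k + 1) (fun i j => g i * (i / (r + 1) - j / (w + 1))) := by
    have h1 := hypSum_red_mul r (w + 1) k fun i _ => g i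
    have h2 := hypSum_white_mul (r + 1) w k fun i _ => g i
    have h3 : hypSum (r + 1) (w + 1) (k + 1)
          (fun i j => g i * ((i : ℝ) / (r + 1) - (j : ℝ) / (w + 1))) =
        ((r : ℝ) + 1)⁻¹ * hypSum (r + 1) (w + 1) (k + 1) (fun i j => (i : ℝ) * g i) -
        ((w : ℝ) + 1)⁻¹ * hypSum (r + 1) (w + 1) (k + 1) (fun i j => (j : ℝ) * g i) := by
      rw [← hypSum_const_mul, ← hypSum_const_mul, ← hypSum_sub]
      exact hypSum_congr fun i j _ _ => by ring
    rw [h3, h1, h2, inv_mul_cancel_left₀ (by positivity), inv_mul_cancel_left₀ (by positivity)]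
    ring
  have hcc : ((r + w + 2).choose (k + 1) : ℝ) / (r + w + 1).choose k =
      (r + w + 2) / (k + 1) := by
    have h1 := choose_div_choose_succ hk
    push_cast at h1
    rw [← inv_div, h1, inv_div]
    ring
  rw [hyp, hyp, show r + 1 + w = r + w + 1 by ring, ← add_assoc r w 1, ← sub_div, e, abs_div,
    Nat.abs_cast, abs_neg]
  calc _ ≤ (r + w + 2).choose (k + 1) * ((r + w + 2) * √(r + w + 2) / ((r + 1) * (w + 1))) /
        (r + w + 1).choose k := by
        gcongr
        exact abs_hypSum_mul_deviation_le (by omega) hg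
    _ = (r + w + 2).choose (k + 1) / (r + w + 1).choose k *
        ((r + w + 2) * √(r + w + 2) / ((r + 1) * (w + 1))) := by ring
    _ = _ := by
      rw [hcc, div_mul_div_comm]
      ring

/-! ### The expectation operator of the chain -/

/-- The expectation of `f` after one step of the `(n, k)`-chain started from `x` red balls in the
left urn.  States above `n` are identified with `n`, which makes Lipschitz bounds global. -/
def step (n k : ℕ) (f : ℕ → ℝ) (x : ℕ) : ℝ :=
  hyp (min x n) (n - min x n) k fun i => hyp (n - min x n) (min x n) k fun u => f (min x n + u - i)

lemma step_of_le {n k x : ℕ} (hx : x ≤ n) (f : ℕ → ℝ) :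
    step n k f x = hyp x (n - x) k fun i => hyp (n - x) x k fun u => f (x + u - i) := by
  rw [step, min_eq_left hx]

lemma step_mono {n k : ℕ} {f g : ℕ → ℝ} (h : ∀ y ≤ n, f y ≤ g y) (x : ℕ) :
    step n k f x ≤ step n k g x :=
  hyp_mono fun i _ => hyp_mono fun u hu => h _ (by omega)

lemma step_congr {n k : ℕ} {f g : ℕ → ℝ} (h : ∀ y ≤ n, f y = g y) (x : ℕ) :
    step n k f x = step n k g x :=
  hyp_congr fun i _ => hyp_congr fun u hu => h _ (by omega)

lemma step_add (n k : ℕ) (f g : ℕ → ℝ) (x : ℕ) :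
    step n k (fun y => f y + g y) x = step n k f x + step n k g x := by
  simp only [step, hyp_add]

lemma step_const_mul (n k : ℕ) (c : ℝ) (f : ℕ → ℝ) (x : ℕ) :
    step n k (fun y => c * f y) x = c * step n k f x := by
  simp only [step, hyp_const_mul]

lemma step_const {n k : ℕ} (hk : k ≤ n) (c : ℝ) (x : ℕ) : step n k (fun _ => c) x = c := by
  rw [step, hyp_congr (g' := fun _ => c) fun i _ => hyp_const (by omega) c, hyp_const (by omega)]

/-- The expectation of `f` after `t` steps. -/
def evol (n k t : ℕ) (f : ℕ → ℝ) : ℕ → ℝ := (step n k)^[t] f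

lemma evol_zero (n k : ℕ) (f : ℕ → ℝ) : evol n k 0 f = f := rfl

lemma evol_succ (n k t : ℕ) (f : ℕ → ℝ) : evol n k (t + 1) f = step n k (evol n k t f) :=
  Function.iterate_succ_apply' _ _ _

lemma evol_add_apply (n k s t : ℕ) (f : ℕ → ℝ) :
    evol n k (s + t) f = evol n k s (evol n k t f) :=
  Function.iterate_add_apply _ _ _ _

lemma evol_mono {n k t : ℕ} {f g : ℕ → ℝ} (h : ∀ y ≤ n, f y ≤ g y) :
    ∀ x ≤ n, evol n k t f x ≤ evol n k t g x := by
  induction t with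
  | zero => exact h
  | succ t ih => intro x _; rw [evol_succ, evol_succ]; exact step_mono ih x

lemma evol_congr {n k t : ℕ} {f g : ℕ → ℝ} (h : ∀ y ≤ n, f y = g y) :
    ∀ x ≤ n, evol n k t f x = evol n k t g x := by
  induction t with
  | zero => exact h
  | succ t ih => intro x _; rw [evol_succ, evol_succ]; exact step_congr ih x

lemma evol_add (n k t : ℕ) (f g : ℕ → ℝ) (x : ℕ) :
    evol n k t (fun y => f y + g y) x = evol n k t f x + evol n k t g x := by
  induction t generalizing x with
  | zero => rfl
  | succ t ih => simp only [evol_succ]; rw [← step_add]; congr 1; exact funext ih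

lemma evol_const_mul (n k t : ℕ) (c : ℝ) (f : ℕ → ℝ) (x : ℕ) :
    evol n k t (fun y => c * f y) x = c * evol n k t f x := by
  induction t generalizing x with
  | zero => rfl
  | succ t ih => simp only [evol_succ]; rw [← step_const_mul]; congr 1; exact funext ih

lemma evol_sub (n k t : ℕ) (f g : ℕ → ℝ) (x : ℕ) :
    evol n k t (fun y => f y - g y) x = evol n k t f x - evol n k t g x := by
  have := evol_add n k t f (fun y => -1 * g y) x
  rw [evol_const_mul] at this
  rw [show (fun y => f y - g y) = fun y => f y + -1 * g y from funext fun y => by ring, this]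
  ring

lemma evol_const {n k : ℕ} (hk : k ≤ n) (t : ℕ) (c : ℝ) (x : ℕ) :
    evol n k t (fun _ => c) x = c := by
  induction t generalizing x with
  | zero => rfl
  | succ t ih =>
    rw [evol_succ, show evol n k t (fun _ => c) = fun _ => c from funext ih, step_const hk]

lemma abs_evol_le_evol_abs (n k t : ℕ) (f : ℕ → ℝ) {x : ℕ} (hx : x ≤ n) :
    |evol n k t f x| ≤ evol n k t (fun y => |f y|) x := by
  rw [abs_le]
  constructor
  · have h : evol n k t (fun y => -1 * |f y|) x ≤ evol n k t f x :=
      evol_mono (fun y _ => by linarith [neg_abs_le (f y)]) x hx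
    rw [evol_const_mul] at h
    linarith
  · exact evol_mono (fun y _ => le_abs_self _) x hx

/-! ### First and second moments -/

/-- The centred count `y - n / 2` is an eigenfunction with eigenvalue `1 - 2k/n`. -/
lemma step_center {n k x : ℕ} (hn : 0 < n) (hk : k ≤ n) (hx : x ≤ n) :
    step n k (fun y => (y : ℝ) - n / 2) x = (1 - 2 * (k / n)) * (x - n / 2) := by
  have hn' : (n : ℝ) ≠ 0 := by positivity
  rw [step_of_le hx]
  have h1 : ∀ i ≤ x, hyp (n - x) x k (fun u => ((x + u - i : ℕ) : ℝ) - n / 2) =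
      ((x : ℝ) - n / 2 + (n - x) * k / n) + -1 * i := by
    intro i hi
    rw [hyp_congr (g' := fun u => ((x : ℝ) - i - n / 2) + u) fun u _ => by
      rw [Nat.cast_sub (by omega)]; push_cast; ring]
    rw [hyp_add, hyp_const (by omega), hyp_mean (by omega), Nat.cast_sub hx]
    rw [sub_add_cancel]; ring
  rw [hyp_congr h1, hyp_add, hyp_const (by omega), hyp_const_mul, hyp_mean (by omega),
    Nat.cast_sub hx, add_sub_cancel]
  field_simp
  ring

lemma step_center_sq_le {n k x : ℕ} (hn : 0 < n) (hk : k ≤ n) (hx : x ≤ n) :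
    step n k (fun y => ((y : ℝ) - n / 2) ^ 2) x ≤
      (1 - 2 * (k / n)) ^ 2 * (x - n / 2) ^ 2 + k := by
  have hn' : (n : ℝ) ≠ 0 := by positivity
  rw [step_of_le hx]
  set m₁ : ℝ := x * k / n with hm₁
  set m₂ : ℝ := (n - x) * k / n with hm₂
  have h1 : ∀ i ≤ x, hyp (n - x) x k (fun u => (((x + u - i : ℕ) : ℝ) - n / 2) ^ 2) ≤
      ((-((x : ℝ) - n / 2 + m₂)) + i) ^ 2 + m₂ := by
    intro i hi
    rw [hyp_congr (g' := fun u => (((x : ℝ) - i - n / 2) + u) ^ 2) fun u _ => by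
      rw [Nat.cast_sub (by omega)]; push_cast; ring]
    refine (hyp_sq_le (by omega) _).trans (le_of_eq ?_)
    rw [Nat.cast_sub hx, sub_add_cancel, ← hm₂]; ring
  refine (hyp_mono h1).trans ?_
  rw [hyp_add, hyp_const (by omega)]
  have h2 := hyp_sq_le (r := x) (w := n - x) (k := k) (by omega) (-((x : ℝ) - n / 2 + m₂))
  rw [Nat.cast_sub hx, add_sub_cancel, ← hm₁] at h2
  have e1 : m₁ + m₂ = k := by rw [hm₁, hm₂]; field_simp; ring
  have e2 : -((x : ℝ) - n / 2 + m₂) + m₁ = -((1 - 2 * (k / n)) * (x - n / 2)) := by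
    rw [hm₁, hm₂]; field_simp; ring
  rw [e2, neg_sq, mul_pow] at h2
  linarith

lemma evol_center {n k x : ℕ} (hn : 0 < n) (hk : k ≤ n) (hx : x ≤ n) (t : ℕ) :
    evol n k t (fun y => (y : ℝ) - n / 2) x = (1 - 2 * (k / n)) ^ t * (x - n / 2) := by
  induction t generalizing x with
  | zero => simp [evol_zero]
  | succ t ih =>
    rw [evol_succ, step_congr (fun y hy => ih hy), step_const_mul, step_center hn hk hx]
    ring

/-- With `p = k / n`, the second moment about `n / 2` relaxes geometrically to at most
`n / (4 (1 - p))`, the fixed point of the recursion given by `step_center_sq_le`. -/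
lemma evol_center_sq_le {n k x : ℕ} (hk : k < n) (hx : x ≤ n) (t : ℕ) :
    evol n k t (fun y => ((y : ℝ) - n / 2) ^ 2) x ≤
      (1 - 2 * (k / n)) ^ (2 * t) * (x - n / 2) ^ 2 + n / (4 * (1 - k / n)) := by
  have hn : (0 : ℝ) < n := by exact_mod_cast (by omega : 0 < n)
  have hk' : (k : ℝ) < n := by exact_mod_cast hk
  have hd : (0 : ℝ) < n - k := by linarith
  have hp : 0 < 1 - (k : ℝ) / n := by rw [sub_pos, div_lt_one hn]; exact hk'
  set V : ℝ := n / (4 * (1 - k / n)) with hV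
  have e : (1 - 2 * ((k : ℝ) / n)) ^ 2 * V + k = V := by
    rw [hV, one_sub_div hn.ne']
    field_simp
    ring
  have h : evol n k t (fun y => ((y : ℝ) - n / 2) ^ 2) x ≤
      (1 - 2 * (k / n)) ^ (2 * t) * (x - n / 2) ^ 2 +
        (1 - (1 - 2 * (k / n)) ^ (2 * t)) * V := by
    induction t generalizing x with
    | zero => simp [evol_zero]
    | succ t ih =>
      rw [evol_succ]
      refine (step_mono (fun y hy => ih hy) x).trans ?_
      rw [step_add, step_const hk.le, step_const_mul]
      have h1 := mul_le_mul_of_nonneg_left (step_center_sq_le (by omega) hk.le hx)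
        (by rw [pow_mul]; positivity : 0 ≤ (1 - 2 * ((k : ℝ) / n)) ^ (2 * t))
      rw [show 2 * (t + 1) = 2 * t + 2 by ring, pow_add]
      linear_combination h1 + (1 - 2 * ((k : ℝ) / n)) ^ (2 * t) * e
  have hV0 : 0 ≤ V := by positivity
  have : 0 ≤ (1 - 2 * ((k : ℝ) / n)) ^ (2 * t) := by rw [pow_mul]; positivity
  nlinarith

/-! ### Contraction of Lipschitz functions -/

/-- One step of the chain contracts Lipschitz constants by `(1 - p) ^ 2 + p ^ 2`, where `p = k / n`.
Two copies started from `x` and `x + 1` are run with the same selections, and differ in the colour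
of one ball of each urn. They stay at distance one if both or none of these balls are selected, and
coalesce otherwise. -/
lemma abs_step_succ_sub_le {n k : ℕ} (hk0 : 0 < k) (hk : k ≤ n) {f : ℕ → ℝ} {L : ℝ}
    (hf : ∀ y, |f (y + 1) - f y| ≤ L) (x : ℕ) :
    |step n k f (x + 1) - step n k f x| ≤ ((1 - k / n : ℝ) ^ 2 + (k / n : ℝ) ^ 2) * L := by
  have hL : 0 ≤ L := (abs_nonneg _).trans (hf 0)
  rcases le_or_gt n x with hx | hx
  · rw [step, step, min_eq_right hx, min_eq_right (by omega), sub_self, abs_zero]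
    positivity
  obtain ⟨k, rfl⟩ : ∃ l, k = l + 1 := ⟨k - 1, by omega⟩
  obtain ⟨w, rfl⟩ : ∃ w, n = x + w + 1 := ⟨n - x - 1, by omega⟩
  rw [step_of_le (by omega), step_of_le (by omega), show x + w + 1 - (x + 1) = w by omega,
    show x + w + 1 - x = w + 1 by omega]
  push_cast
  set p : ℝ := (k + 1) / (x + w + 1) with hp
  have hp1 : p ≤ 1 := by
    rw [hp, div_le_one (by positivity)]
    exact_mod_cast hk
  have hp0 : 0 ≤ p := by positivity
  simp only [hyp_red_succ (show k ≤ x + w by omega), hyp_white_succ (show k ≤ x + w by omega),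
    hyp_red_succ (show k ≤ w + x by omega), hyp_white_succ (show k ≤ w + x by omega),
    hyp_add, hyp_const_mul, add_comm (w : ℝ) x, ← hp]
  have e1 (i u : ℕ) : x + 1 + u - (i + 1) = x + u - i := by omega
  have e2 (i u : ℕ) : x + (u + 1) - i = x + 1 + u - i := by omega
  simp only [e1, e2]
  have hd (i u : ℕ) : |f (x + 1 + u - i) - f (x + u - i)| ≤ L := by
    rcases le_or_gt i (x + u) with h | h
    · rw [show x + 1 + u - i = x + u - i + 1 by omega]; exact hf _
    · rw [show x + 1 + u - i = x + u - i by omega, sub_self, abs_zero]; exact hL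
  have key (l m : ℕ) : |(hyp x w l fun i => hyp w x m fun u => f (x + 1 + u - i)) -
      hyp x w l fun i => hyp w x m fun u => f (x + u - i)| ≤ L := by
    rw [← hyp_sub]
    refine abs_hyp_le _ _ _ hL fun i _ => ?_
    rw [← hyp_sub]
    exact abs_hyp_le _ _ _ hL fun u _ => hd i u
  have k1 := abs_le.mp (key (k + 1) (k + 1))
  have k2 := abs_le.mp (key k k)
  have q1 : 0 ≤ (1 - p) ^ 2 := by positivity
  have q2 : 0 ≤ p ^ 2 := by positivity
  rw [abs_le]
  constructor
  · nlinarith [mul_le_mul_of_nonneg_left k1.1 q1, mul_le_mul_of_nonneg_left k2.2 q2]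
  · nlinarith [mul_le_mul_of_nonneg_left k1.2 q1, mul_le_mul_of_nonneg_left k2.1 q2]

lemma abs_evol_succ_sub_le {n k : ℕ} (hk0 : 0 < k) (hk : k ≤ n) {f : ℕ → ℝ} {L : ℝ}
    (hf : ∀ y, |f (y + 1) - f y| ≤ L) (t x : ℕ) :
    |evol n k t f (x + 1) - evol n k t f x| ≤
      ((1 - k / n : ℝ) ^ 2 + (k / n : ℝ) ^ 2) ^ t * L := by
  induction t generalizing x with
  | zero => simpa [evol_zero] using hf x
  | succ t ih =>
    rw [evol_succ, pow_succ', mul_assoc]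
    exact abs_step_succ_sub_le hk0 hk ih x

lemma abs_sub_le_of_abs_succ_sub_le {f : ℕ → ℝ} {L : ℝ} (hf : ∀ y, |f (y + 1) - f y| ≤ L)
    (x y : ℕ) : |f x - f y| ≤ L * |(x : ℝ) - y| := by
  have h (a d : ℕ) : |f (a + d) - f a| ≤ L * d := by
    induction d with
    | zero => simp
    | succ d ih =>
      have h1 := abs_sub_le (f (a + (d + 1))) (f (a + d)) (f a)
      have h2 := hf (a + d)
      rw [add_assoc] at h2
      push_cast
      linarith
  rcases le_total x y with hxy | hxy
  · obtain ⟨d, rfl⟩ := Nat.exists_eq_add_of_le hxy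
    rw [abs_sub_comm, abs_sub_comm (x : ℝ)]
    simpa using h x d
  · obtain ⟨d, rfl⟩ := Nat.exists_eq_add_of_le hxy
    simpa using h y d

/-- One step of the chain turns a bounded function into one with Lipschitz constant of order
`n ^ (-1/2)` on the bulk of the state space. -/
lemma abs_step_succ_sub_le_of_abs_le_one {n k x : ℕ} (hk : k ≤ n) (hx : x < n) {f : ℕ → ℝ}
    (hf : ∀ y, |f y| ≤ 1) :
    |step n k f (x + 1) - step n k f x| ≤
      (n + 1) ^ 2 * √(n + 1) / ((x + 1) * (n - x)) * (1 / (k + 1) + 1 / (n + 1 - k)) := by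
  obtain ⟨w, rfl⟩ : ∃ w, n = x + w + 1 := ⟨n - x - 1, by omega⟩
  have hk' : (k : ℝ) ≤ x + w + 1 := by exact_mod_cast hk
  have hd : (0 : ℝ) < x + w + 2 - k := by linarith
  rw [step_of_le (by omega), step_of_le (by omega), show x + w + 1 - (x + 1) = w by omega,
    show x + w + 1 - x = w + 1 by omega]
  -- From `x` to `x + 1` one ball of each urn is recoloured. The shift of the state by one is
  -- absorbed into the number `i` of red balls that leave the left urn.
  have h1 := abs_hyp_recolour_shift_le (r := x) (w := w) (k := k) (by omega)
    (g := fun i => hyp w (x + 1) k fun u => f (x + 1 + u - i))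
    fun i => abs_hyp_le _ _ _ zero_le_one fun u _ => hf _
  have e1 (i u : ℕ) : x + 1 + u - (i + 1) = x + u - i := by omega
  simp only [e1] at h1
  have h2 : |hyp x (w + 1) k (fun i => hyp w (x + 1) k fun u => f (x + u - i)) -
      hyp x (w + 1) k (fun i => hyp (w + 1) x k fun u => f (x + u - i))| ≤
      (w + x + 2) ^ 2 * √(w + x + 2) / ((w + x + 2 - k) * ((w + 1) * (x + 1))) := by
    rw [← hyp_sub]
    refine abs_hyp_le _ _ _ ?_ fun i _ => ?_
    · rw [add_comm (w : ℝ)]; positivity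
    · rw [abs_sub_comm]
      exact abs_hyp_recolour_le (by omega) fun u => hf _
  refine (abs_sub_le _ _ _).trans ((add_le_add h1 h2).trans (le_of_eq ?_))
  push_cast
  rw [add_comm (w : ℝ) x, show (x : ℝ) + w + 1 + 1 = x + w + 2 by ring,
    show (x : ℝ) + w + 1 - x = w + 1 by ring]
  field_simp

/-! ### Transition probabilities and the stationary distribution -/

open Finset in
/-- The numbers of elements that a uniform `k`-subset of a disjoint union takes from the two parts
are hypergeometric. -/
lemma sum_powersetCard_union {α : Type*} [DecidableEq α] {s t : Finset α} (h : Disjoint s t)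
    (k : ℕ) (g : ℕ → ℝ) :
    ∑ S ∈ powersetCard k (s ∪ t), g (S ∩ s).card = hypSum s.card t.card k fun i _ => g i := by
  unfold hypSum
  have hmap : ∀ S ∈ powersetCard k (s ∪ t),
      ((S ∩ s).card, (S ∩ t).card) ∈ HasAntidiagonal.antidiagonal k := by
    intro S hS
    rw [mem_powersetCard] at hS
    rw [HasAntidiagonal.mem_antidiagonal, ← hS.2,
      ← card_union_of_disjoint (h.mono inter_subset_right inter_subset_right),
      ← inter_union_distrib_left, inter_eq_left.mpr hS.1]
  rw [← sum_fiberwise_of_maps_to hmap]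
  refine sum_congr rfl fun ij hij => ?_
  rw [HasAntidiagonal.mem_antidiagonal] at hij
  have hcard : (filter (fun S => ((S ∩ s).card, (S ∩ t).card) = ij)
      (powersetCard k (s ∪ t))).card = s.card.choose ij.1 * t.card.choose ij.2 := by
    rw [← card_powersetCard, ← card_powersetCard, ← card_product]
    refine card_nbij' (fun S => (S ∩ s, S ∩ t)) (fun P => P.1 ∪ P.2) ?_ ?_ ?_ ?_
    · intro S hS
      simp only [coe_filter, Set.mem_ofPred_eq, Prod.ext_iff] at hS
      simp [mem_powersetCard, hS.2.1, hS.2.2, inter_subset_right]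
    · rintro ⟨A, B⟩ hAB
      simp only [coe_product, Set.mem_prod, mem_coe, mem_powersetCard] at hAB
      obtain ⟨⟨hA, hA'⟩, hB, hB'⟩ := hAB
      have e1 : (A ∪ B) ∩ s = A := by
        rw [union_inter_distrib_right, inter_eq_left.mpr hA,
          disjoint_iff_inter_eq_empty.mp (h.symm.mono_left hB), union_empty]
      have e2 : (A ∪ B) ∩ t = B := by
        rw [union_inter_distrib_right, inter_eq_left.mpr hB,
          disjoint_iff_inter_eq_empty.mp (h.mono_left hA), empty_union]
      simp only [coe_filter, Set.mem_ofPred_eq, mem_powersetCard, e1, e2, hA', hB', and_true]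
      refine ⟨union_subset_union hA hB, ?_⟩
      rw [card_union_of_disjoint (h.mono hA hB), hA', hB', hij]
    · intro S hS
      simp only [coe_filter, Set.mem_ofPred_eq, mem_powersetCard] at hS
      simp only [← inter_union_distrib_left, inter_eq_left.mpr hS.1.1]
    · rintro ⟨A, B⟩ hAB
      simp only [coe_product, Set.mem_prod, mem_coe, mem_powersetCard] at hAB
      obtain ⟨⟨hA, hA'⟩, hB, hB'⟩ := hAB
      have e1 : (A ∪ B) ∩ s = A := by
        rw [union_inter_distrib_right, inter_eq_left.mpr hA,
          disjoint_iff_inter_eq_empty.mp (h.symm.mono_left hB), union_empty]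
      have e2 : (A ∪ B) ∩ t = B := by
        rw [union_inter_distrib_right, inter_eq_left.mpr hB,
          disjoint_iff_inter_eq_empty.mp (h.mono_left hA), empty_union]
      simp only [e1, e2]
  rw [sum_congr rfl (g := fun _ => g ij.1) fun S hS => by
    rw [← (mem_filter.mp hS).2], sum_const, hcard, nsmul_eq_mul, Nat.cast_mul]

lemma sum_powersetCard_redSelected {n r : ℕ} (hr : r ≤ n) (k : ℕ) (g : ℕ → ℝ) :
    ∑ S ∈ Finset.powersetCard k (Finset.univ : Finset (Fin n)), g (redSelected r S) =
      hypSum r (n - r) k fun i _ => g i := by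
  set s : Finset (Fin n) := Finset.univ.filter fun b => (b : ℕ) < r with hs
  have hc : s.card = r := by
    rw [hs, Fin.card_filter_val_lt, min_eq_right hr]
  have hc' : sᶜ.card = n - r := by rw [Finset.card_compl, hc, Fintype.card_fin]
  have h := sum_powersetCard_union (disjoint_compl_right (a := s)) k g
  rw [Finset.union_compl, hc, hc'] at h
  rw [← h]
  refine Finset.sum_congr rfl fun S _ => ?_
  rw [redSelected, hs, Finset.inter_filter, Finset.inter_univ]

lemma redSelected_le {n r : ℕ} (hr : r ≤ n) (S : Finset (Fin n)) : redSelected r S ≤ r := by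
  calc redSelected r S ≤ (Finset.univ.filter fun b : Fin n => (b : ℕ) < r).card :=
        Finset.card_le_card (Finset.filter_subset_filter _ (Finset.subset_univ _))
    _ = r := by rw [Fin.card_filter_val_lt, min_eq_right hr]

/-- Averages over the selections of a step, in terms of the numbers of red balls selected. -/
lemma sum_selections_div {n k x : ℕ} (hx : x ≤ n) (g : ℕ → ℕ → ℝ) :
    (∑ AB ∈ selections n k, g (redSelected x AB.1) (redSelected (n - x) AB.2)) /
      (selections n k).card = hyp x (n - x) k fun i => hyp (n - x) x k fun u => g i u := by
  have hcard : ((selections n k).card : ℝ) = n.choose k * n.choose k := by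
    simp [selections]
  have hin (i : ℕ) : ∑ B ∈ Finset.powersetCard k (Finset.univ : Finset (Fin n)),
      g i (redSelected (n - x) B) = n.choose k * hyp (n - x) x k fun u => g i u := by
    rw [sum_powersetCard_redSelected (Nat.sub_le n x) k fun u => g i u, hypSum_eq,
      Nat.sub_sub_self hx, Nat.sub_add_cancel hx]
  rw [hcard, selections, Finset.sum_product]
  simp only [hin]
  rw [sum_powersetCard_redSelected hx k fun i => n.choose k * hyp (n - x) x k fun u => g i u,
    hypSum_const_mul, hypSum_eq, Nat.add_sub_cancel' hx]
  by_cases h0 : (n.choose k : ℝ) = 0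
  · have : n < k := by
      by_contra h
      exact (Nat.choose_pos (not_lt.mp h)).ne' (by exact_mod_cast h0)
    rw [h0, hyp, Nat.add_sub_cancel' hx, Nat.choose_eq_zero_of_lt this]
    simp
  · rw [← mul_assoc, mul_div_cancel_left₀ _ (mul_ne_zero h0 h0)]

lemma transition_eq_hyp {n k : ℕ} (x y : Fin (n + 1)) :
    transition n k x y = hyp x (n - x) k fun i => hyp (n - x) x k fun u =>
      if (x : ℕ) + u = y + i then 1 else 0 := by
  rw [← sum_selections_div (by omega), transition, Finset.card_filter]
  push_cast
  rfl

/-- `step` is the expectation with respect to the transition matrix. -/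
lemma sum_transition_mul {n k : ℕ} (f : ℕ → ℝ) (x : Fin (n + 1)) :
    ∑ y, transition n k x y * f y = step n k f x := by
  have hx : (x : ℕ) ≤ n := by omega
  rw [step_of_le hx, ← sum_selections_div hx fun i u => f (x + u - i)]
  simp only [transition, Finset.card_filter, Nat.cast_sum, div_mul_eq_mul_div, Finset.sum_mul]
  rw [← Finset.sum_div, Finset.sum_comm]
  congr 1
  refine Finset.sum_congr rfl fun AB _ => ?_
  have ha := redSelected_le hx AB.1
  have hb := redSelected_le (Nat.sub_le n x) AB.2
  rw [Finset.sum_eq_single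
    (⟨x + redSelected (n - x) AB.2 - redSelected x AB.1, by omega⟩ : Fin (n + 1))]
  · simp only
    rw [if_pos (by omega)]
    simp
  · intro y _ hy
    rw [if_neg]
    · simp
    · intro h
      apply hy
      ext
      simp only
      omega
  · simp

/-- `evol` is the expectation with respect to the `t`-step transition probabilities. -/
lemma sum_transitionProb_mul {n k : ℕ} (t : ℕ) (f : ℕ → ℝ) (x : Fin (n + 1)) :
    ∑ y, transitionProb n k t x y * f y = evol n k t f x := by
  induction t generalizing x with
  | zero => simp [transitionProb, Matrix.one_apply, evol_zero]
  | succ t ih =>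
    rw [evol_succ, ← sum_transition_mul]
    simp only [← ih, transitionProb, pow_succ', Matrix.mul_apply, Finset.mul_sum, Finset.sum_mul]
    rw [Finset.sum_comm]
    exact Finset.sum_congr rfl fun y _ => Finset.sum_congr rfl fun z _ => by ring

lemma sum_stationary (n : ℕ) : ∑ x, stationary n x = 1 := by
  have h : ∑ x : Fin (n + 1), (n.choose (x : ℕ) : ℝ) * (n.choose (n - (x : ℕ)) : ℝ) =
      ((2 * n).choose n : ℝ) := by
    rw [Fin.sum_univ_eq_sum_range fun x => (n.choose x : ℝ) * (n.choose (n - x) : ℝ), two_mul,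
      Nat.add_choose_eq, Finset.Nat.sum_antidiagonal_eq_sum_range_succ_mk]
    push_cast
    rfl
  have h0 : ((2 * n).choose n : ℝ) ≠ 0 := by
    exact_mod_cast (Nat.choose_pos (by omega)).ne'
  simp only [stationary]
  rw [← Finset.sum_div, h, div_self h0]

lemma stationary_nonneg (n : ℕ) (x : Fin (n + 1)) : 0 ≤ stationary n x := by
  unfold stationary; positivity

/-- Summed over the colourings of `i + a + (j + b)` balls with `i + a` red ones, the numbers of
selections of `i` red and `j` white balls add up to a multinomial coefficient. -/
lemma choose_mul_choose_mul_choose (i a j b : ℕ) :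
    ((i + a + (j + b)).choose (i + a) * ((i + a).choose i * (j + b).choose j)) *
      (i.factorial * a.factorial * (j.factorial * b.factorial)) =
        (i + a + (j + b)).factorial := by
  rw [Nat.choose_symm_add, Nat.choose_symm_add (a := i), Nat.choose_symm_add (a := j),
    ← Nat.add_choose_mul_factorial_mul_factorial (i + a) (j + b),
    ← Nat.add_choose_mul_factorial_mul_factorial i a,
    ← Nat.add_choose_mul_factorial_mul_factorial j b]
  ring

/-- The numbers of colourings and selections that lead from state `x` to `y` and back agree. -/
lemma choose_balance {n k x y i j u v : ℕ} (hx : x ≤ n) (hy : y ≤ n) (hij : i + j = k)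
    (huv : u + v = k) (hxy : x + u = y + i) :
    (n.choose x * (x.choose i * (n - x).choose j)) *
        (n.choose (n - x) * ((n - x).choose u * x.choose v)) =
      (n.choose y * (y.choose u * (n - y).choose v)) *
        (n.choose (n - y) * ((n - y).choose i * y.choose j)) := by
  by_cases h : i ≤ x ∧ j ≤ n - x ∧ u ≤ n - x ∧ v ≤ x
  · obtain ⟨hi, hj, hu, hv⟩ := h
    obtain ⟨a, ha⟩ := Nat.exists_eq_add_of_le hi
    obtain ⟨b, hb⟩ := Nat.exists_eq_add_of_le hj
    obtain ⟨c, hc⟩ := Nat.exists_eq_add_of_le hu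
    obtain ⟨d, hd⟩ := Nat.exists_eq_add_of_le hv
    have e1 := choose_mul_choose_mul_choose i a j b
    have e2 := choose_mul_choose_mul_choose u c v d
    have e3 := choose_mul_choose_mul_choose u a v b
    have e4 := choose_mul_choose_mul_choose i c j d
    rw [← ha, ← hb, show x + (n - x) = n by omega] at e1
    rw [← hc, ← hd, show n - x + x = n by omega] at e2
    rw [show u + a = y by omega, show v + b = n - y by omega, show y + (n - y) = n by omega] at e3
    rw [show i + c = n - y by omega, show j + d = y by omega, show n - y + y = n by omega] at e4
    have hpos : 0 < (i.factorial * a.factorial * (j.factorial * b.factorial)) *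
        (u.factorial * c.factorial * (v.factorial * d.factorial)) := by positivity
    refine Nat.eq_of_mul_eq_mul_right hpos ?_
    have e := congrArg₂ (· * ·) (e1.trans e3.symm) (e2.trans e4.symm)
    exact Eq.trans (by ring) (e.trans (by ring))
  · have hl : x.choose i * (n - x).choose j * ((n - x).choose u * x.choose v) = 0 := by
      simp only [mul_eq_zero, Nat.choose_eq_zero_iff]
      omega
    have hr : y.choose u * (n - y).choose v * ((n - y).choose i * y.choose j) = 0 := by
      simp only [mul_eq_zero, Nat.choose_eq_zero_iff]
      omega
    calc _ = n.choose x * n.choose (n - x) *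
          (x.choose i * (n - x).choose j * ((n - x).choose u * x.choose v)) := by ring
      _ = n.choose y * n.choose (n - y) *
          (y.choose u * (n - y).choose v * ((n - y).choose i * y.choose j)) := by rw [hl, hr]; simp
      _ = _ := by ring

/-- The chain is reversible. -/
lemma stationary_mul_transition {n k : ℕ} (x y : Fin (n + 1)) :
    stationary n x * transition n k x y = stationary n y * transition n k y x := by
  have hx : (x : ℕ) ≤ n := by omega
  have hy : (y : ℕ) ≤ n := by omega
  have key (x y : Fin (n + 1)) : stationary n x * transition n k x y =
      (∑ p ∈ Finset.HasAntidiagonal.antidiagonal k, ∑ q ∈ Finset.HasAntidiagonal.antidiagonal k,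
        (((n.choose x * ((x : ℕ).choose p.1 * (n - x).choose p.2)) *
          (n.choose (n - x) * ((n - x).choose q.1 * (x : ℕ).choose q.2)) : ℕ) : ℝ) *
          if (x : ℕ) + q.1 = y + p.1 then 1 else 0) /
        ((2 * n).choose n * (n.choose k * n.choose k)) := by
    have hx : (x : ℕ) ≤ n := by omega
    rw [transition_eq_hyp, stationary]
    simp only [hyp, hypSum, Nat.add_sub_cancel' hx, Nat.sub_add_cancel hx, Finset.mul_sum,
      Finset.sum_div]
    refine Finset.sum_congr rfl fun p _ => Finset.sum_congr rfl fun q _ => ?_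
    push_cast
    ring
  rw [key, key, Finset.sum_comm]
  congr 1
  refine Finset.sum_congr rfl fun q hq => Finset.sum_congr rfl fun p hp => ?_
  rw [Finset.HasAntidiagonal.mem_antidiagonal] at hp hq
  by_cases h : (x : ℕ) + q.1 = y + p.1
  · rw [if_pos h, if_pos h.symm, choose_balance hx hy hp hq h]
  · rw [if_neg h, if_neg (Ne.symm h)]; simp

lemma sum_stationary_mul_step {n k : ℕ} (hk : k ≤ n) (f : ℕ → ℝ) :
    ∑ x, stationary n x * step n k f x = ∑ x, stationary n x * f x := by
  have hrow (y : Fin (n + 1)) : ∑ x, transition n k y x = 1 := by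
    simpa [step_const hk] using sum_transition_mul (k := k) (fun _ => 1) y
  simp only [← sum_transition_mul, Finset.mul_sum]
  rw [Finset.sum_comm]
  refine Finset.sum_congr rfl fun y _ => ?_
  simp only [← mul_assoc, stationary_mul_transition _ y]
  rw [← Finset.sum_mul, ← Finset.mul_sum, hrow, mul_one]

lemma sum_stationary_mul_evol {n k : ℕ} (hk : k ≤ n) (t : ℕ) (f : ℕ → ℝ) :
    ∑ x, stationary n x * evol n k t f x = ∑ x, stationary n x * f x := by
  induction t with
  | zero => rfl
  | succ t ih => rw [evol_succ, sum_stationary_mul_step hk, ih]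

/-! ### Total variation distance and test functions -/

/-- If all expectations `evol n k t f x` of functions bounded by one are within `B` of a constant,
then the distance to stationarity is at most `B`. -/
lemma distToStationary_le {n k t : ℕ} (hk : k ≤ n) {B : ℝ}
    (h : ∀ f : ℕ → ℝ, (∀ y, |f y| ≤ 1) → ∃ c, ∀ x ≤ n, |evol n k t f x - c| ≤ B) :
    distToStationary n k t ≤ B := by
  refine Finset.sup'_le _ _ fun x _ => ?_
  -- The test function is the sign of the difference of the two mass functions.
  set μ := transitionProb n k t x with hμ
  obtain ⟨c, hc⟩ := h
    (fun y => if hy : y < n + 1 then SignType.sign (μ ⟨y, hy⟩ - stationary n ⟨y, hy⟩) else 0)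
    fun y => by
      split_ifs with hy
      · rcases SignType.sign (μ ⟨y, hy⟩ - stationary n ⟨y, hy⟩) with _ | _ | _ <;> simp
      · simp
  set f : ℕ → ℝ := fun y =>
    if hy : y < n + 1 then SignType.sign (μ ⟨y, hy⟩ - stationary n ⟨y, hy⟩) else 0 with hf
  have h1 : ∑ y, |μ y - stationary n y| =
      evol n k t f x - ∑ z, stationary n z * evol n k t f z := by
    rw [sum_stationary_mul_evol hk, ← sum_transitionProb_mul, ← Finset.sum_sub_distrib]
    refine Finset.sum_congr rfl fun y _ => ?_
    have : f y = SignType.sign (μ y - stationary n y) := by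
      simp only [hf]; rw [dif_pos y.isLt]
    rw [this, ← sub_mul, self_mul_sign]
  have h2 : |c - ∑ z, stationary n z * evol n k t f z| ≤ B := by
    have : c - ∑ z, stationary n z * evol n k t f z =
        ∑ z, stationary n z * (c - evol n k t f z) := by
      simp only [mul_sub, Finset.sum_sub_distrib, ← Finset.sum_mul, sum_stationary, one_mul]
    rw [this]
    calc _ ≤ ∑ z, |stationary n z * (c - evol n k t f z)| := Finset.abs_sum_le_sum_abs _ _
      _ ≤ ∑ z, stationary n z * B := by
        refine Finset.sum_le_sum fun z _ => ?_
        rw [abs_mul, abs_of_nonneg (stationary_nonneg n z), abs_sub_comm]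
        exact mul_le_mul_of_nonneg_left (hc z (by omega)) (stationary_nonneg n z)
      _ = B := by rw [← Finset.sum_mul, sum_stationary, one_mul]
  rw [tvDist, h1]
  have h3 := (abs_le.mp (hc x (by omega))).2
  have h4 := (abs_le.mp h2).2
  linarith

/-- Any function with values in `[-1, 1]` gives a lower bound on the distance to stationarity. -/
lemma le_distToStationary {n k t x : ℕ} (hx : x ≤ n) {f : ℕ → ℝ} (hf : ∀ y, |f y| ≤ 1) :
    (1 / 2) * (evol n k t f x - ∑ z : Fin (n + 1), stationary n z * f z) ≤
      distToStationary n k t := by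
  let x' : Fin (n + 1) := ⟨x, by omega⟩
  refine le_trans ?_ (Finset.le_sup' (fun x => tvDist (transitionProb n k t x) (stationary n))
    (Finset.mem_univ x'))
  rw [tvDist]
  refine mul_le_mul_of_nonneg_left ?_ (by norm_num)
  rw [show evol n k t f x = evol n k t f x' from rfl, ← sum_transitionProb_mul,
    ← Finset.sum_sub_distrib]
  refine Finset.sum_le_sum fun y _ => ?_
  rw [← sub_mul]
  refine (le_abs_self _).trans ?_
  rw [abs_mul]
  exact mul_le_of_le_one_right (abs_nonneg _) (hf y)

/-! ### Non-asymptotic bounds on the distance to stationarity -/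

lemma contraction_nonneg_lt_one {n k : ℕ} (hk0 : 0 < k) (hk : k < n) :
    0 ≤ (1 - k / n : ℝ) ^ 2 + (k / n : ℝ) ^ 2 ∧ (1 - k / n : ℝ) ^ 2 + (k / n : ℝ) ^ 2 < 1 := by
  have hn : (0 : ℝ) < n := by exact_mod_cast hk0.trans hk
  have h1 : (k : ℝ) / n < 1 := by rw [div_lt_one hn]; exact_mod_cast hk
  have h0 : 0 < (k : ℝ) / n := by positivity
  exact ⟨by positivity, by nlinarith⟩

lemma distToStationary_le_pow {n k : ℕ} (hk0 : 0 < k) (hk : k < n) (t : ℕ) :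
    distToStationary n k t ≤ ((1 - k / n : ℝ) ^ 2 + (k / n : ℝ) ^ 2) ^ t * 2 * n := by
  refine distToStationary_le hk.le fun f hf => ⟨evol n k t f 0, fun x hx => ?_⟩
  have h1 := abs_evol_succ_sub_le hk0 hk.le (f := f) (L := 2) (fun y => by
    have := abs_le.mp (hf y)
    have := abs_le.mp (hf (y + 1))
    rw [abs_le]; constructor <;> linarith) t
  refine (abs_sub_le_of_abs_succ_sub_le h1 x 0).trans ?_
  have h2 := (contraction_nonneg_lt_one hk0 hk).1
  rw [Nat.cast_zero, sub_zero, Nat.abs_cast]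
  gcongr

lemma exists_distToStationary_le {n k : ℕ} (hk0 : 0 < k) (hk : k < n) {ε : ℝ} (hε : 0 < ε) :
    ∃ t, distToStationary n k t ≤ ε := by
  obtain ⟨h0, h1⟩ := contraction_nonneg_lt_one hk0 hk
  have h2 : Tendsto (fun t : ℕ => ((1 - k / n : ℝ) ^ 2 + (k / n : ℝ) ^ 2) ^ t * 2 * (n : ℝ)) atTop
      (𝓝 (0 * 2 * (n : ℝ))) :=
    ((tendsto_pow_atTop_nhds_zero_of_lt_one h0 h1).mul_const 2).mul_const (n : ℝ)
  rw [zero_mul, zero_mul] at h2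
  obtain ⟨t, ht⟩ := (h2.eventually (gt_mem_nhds hε)).exists
  exact ⟨t, (distToStationary_le_pow hk0 hk t).trans ht.le⟩

lemma isLeast_mixingTime {n k : ℕ} (hk0 : 0 < k) (hk : k < n) {ε : ℝ} (hε : 0 < ε) :
    IsLeast {t : ℕ | distToStationary n k t ≤ ε} (mixingTime n k ε) :=
  ⟨Nat.sInf_mem (exists_distToStationary_le hk0 hk hε), fun _ ht => Nat.sInf_le ht⟩

/-- The value of `step n k f` at the point of the bulk nearest to `y`, the bulk being the interval of
the natural numbers from `⌊n / 4⌋` to `n - ⌊n / 4⌋`. -/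
def bulkStep (n k : ℕ) (f : ℕ → ℝ) (y : ℕ) : ℝ :=
  step n k f (max (n / 4) (min (n - n / 4) y))

lemma abs_bulkStep_succ_sub_le {n k : ℕ} {p : ℝ} (hp0 : 0 < p)
    (hpk : p * n ≤ k) (hn : 0 < n) (hk : 2 * k ≤ n) {f : ℕ → ℝ} (hf : ∀ y, |f y| ≤ 1) (y : ℕ) :
    |bulkStep n k f (y + 1) - bulkStep n k f y| ≤ 384 / (p * √n) := by
  have hn' : (1 : ℝ) ≤ n := by exact_mod_cast hn
  have hn0 : (0 : ℝ) < n := by linarith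
  have hs : 0 < √(n : ℝ) := Real.sqrt_pos.mpr hn0
  unfold bulkStep
  by_cases hy : n / 4 ≤ y ∧ y < n - n / 4
  · rw [min_eq_right (by omega : y + 1 ≤ n - n / 4), min_eq_right hy.2.le,
      max_eq_right (by omega : n / 4 ≤ y + 1), max_eq_right hy.1]
    refine (abs_step_succ_sub_le_of_abs_le_one (by omega) (by omega) hf).trans ?_
    have h1 : (n : ℝ) / 4 ≤ y + 1 := by
      have : (n : ℝ) ≤ 4 * (y + 1) := by exact_mod_cast (by omega : n ≤ 4 * (y + 1))
      linarith
    have h2 : (n : ℝ) / 4 ≤ n - y := by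
      have : (4 : ℝ) * y ≤ 3 * n := by exact_mod_cast (by omega : 4 * y ≤ 3 * n)
      linarith
    have hk' : (2 : ℝ) * k ≤ n := by exact_mod_cast hk
    have h3 : √((n : ℝ) + 1) ≤ 2 * √n := by
      rw [Real.sqrt_le_left (by positivity), mul_pow, Real.sq_sqrt hn0.le]
      linarith
    have h4 : 1 / ((k : ℝ) + 1) ≤ 1 / (p * n) :=
      one_div_le_one_div_of_le (by positivity) (by linarith)
    have h5 : 1 / ((n : ℝ) + 1 - k) ≤ 2 / (p * n) := by
      rw [div_le_div_iff₀ (by linarith) (by positivity)]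
      nlinarith
    have h6 : 1 / ((k : ℝ) + 1) + 1 / ((n : ℝ) + 1 - k) ≤ 3 / (p * n) := by
      calc _ ≤ 1 / (p * n) + 2 / (p * n) := add_le_add h4 h5
        _ = _ := by ring
    have h7 : ((n : ℝ) + 1) ^ 2 * √(n + 1) / ((y + 1) * (n - y)) ≤
        (2 * n) ^ 2 * (2 * √n) / (n / 4 * (n / 4)) := by
      gcongr
      linarith
    calc _ ≤ (2 * (n : ℝ)) ^ 2 * (2 * √n) / (n / 4 * (n / 4)) * (3 / (p * n)) := by
          refine mul_le_mul h7 h6 ?_ (by positivity)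
          have : (0 : ℝ) < n + 1 - k := by linarith
          positivity
      _ = _ := by
        rw [div_mul_div_comm, div_eq_div_iff (by positivity) (by positivity)]
        have e : √(n : ℝ) ^ 2 = n := Real.sq_sqrt hn0.le
        linear_combination 24 * p * n ^ 2 * e
  · rw [show max (n / 4) (min (n - n / 4) (y + 1)) = max (n / 4) (min (n - n / 4) y) by omega,
      sub_self, abs_zero]
    positivity

lemma abs_step_sub_bulkStep_le {n k : ℕ} (hn : 0 < n) {f : ℕ → ℝ} (hf : ∀ y, |f y| ≤ 1)
    (y : ℕ) :
    |step n k f y - bulkStep n k f y| ≤ 32 / n ^ 2 * ((y : ℝ) - n / 2) ^ 2 := by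
  have hn0 : (0 : ℝ) < n := by exact_mod_cast hn
  have hb (x : ℕ) : |step n k f x| ≤ 1 :=
    abs_hyp_le _ _ _ zero_le_one fun i _ => abs_hyp_le _ _ _ zero_le_one fun u _ => hf _
  unfold bulkStep
  by_cases hy : n / 4 ≤ y ∧ y ≤ n - n / 4
  · rw [min_eq_right hy.2, max_eq_right hy.1, sub_self, abs_zero]
    positivity
  · have h1 : ((n : ℝ) / 4) ^ 2 ≤ ((y : ℝ) - n / 2) ^ 2 := by
      rcases (by omega : 4 * y ≤ n ∨ 3 * n ≤ 4 * y) with h | h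
      · have : (4 : ℝ) * y ≤ n := by exact_mod_cast h
        nlinarith
      · have : (3 : ℝ) * n ≤ 4 * y := by exact_mod_cast h
        nlinarith
    have h2 : (2 : ℝ) ≤ 32 / n ^ 2 * ((y : ℝ) - n / 2) ^ 2 := by
      calc (2 : ℝ) = 32 / n ^ 2 * (n / 4) ^ 2 := by field_simp; norm_num
        _ ≤ _ := by gcongr
    have h3 := abs_le.mp (hb y)
    have h4 := abs_le.mp (hb (max (n / 4) (min (n - n / 4) y)))
    refine le_trans ?_ h2
    rw [abs_le]
    constructor <;> linarith

/-- After `t` steps with `n (1 - 2 k / n) ^ (2 t) ≤ A` the state is within order `√n` of `n / 2`.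
In the next `s` steps two copies of the chain come geometrically closer, and one more step couples
copies whose distance is small compared with `√n`. -/
lemma distToStationary_add_le {n k t s : ℕ} {p A : ℝ} (hp0 : 0 < p)
    (hpk : p * n ≤ k) (hn : 0 < n) (hk : 2 * k ≤ n)
    (hA : n * (1 - 2 * (k / n : ℝ)) ^ (2 * t) ≤ A) :
    distToStationary n k (t + s + 1) ≤
      (A + 2) * (384 / p * ((1 - k / n : ℝ) ^ 2 + (k / n : ℝ) ^ 2) ^ s + 8 / n) := by
  have hn1 : (1 : ℝ) ≤ n := by exact_mod_cast hn
  have hn0 : (0 : ℝ) < n := by linarith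
  have hs0 : 0 < √(n : ℝ) := Real.sqrt_pos.mpr hn0
  have hs1 : 1 ≤ √(n : ℝ) := Real.one_le_sqrt.mpr hn1
  have hss : √(n : ℝ) * √n = n := Real.mul_self_sqrt hn0.le
  have hk' : (2 : ℝ) * k ≤ n := by exact_mod_cast hk
  have hk0 : 0 < k := by
    have : (0 : ℝ) < k := lt_of_lt_of_le (by positivity) hpk
    exact_mod_cast this
  have hkn : k < n := by omega
  set q : ℝ := k / n with hq
  have hq0 : 0 < q := by positivity
  have hq1 : q ≤ 1 / 2 := by rw [hq, div_le_iff₀ hn0]; linarith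
  set ρ : ℝ := (1 - q) ^ 2 + q ^ 2 with hρ
  have hρ0 : 0 ≤ ρ := by positivity
  have hA0 : 0 ≤ A := le_trans (by rw [pow_mul]; positivity) hA
  have hvar : ∀ r ≥ t, ∀ x ≤ n,
      evol n k r (fun y => ((y : ℝ) - n / 2) ^ 2) x ≤ n * (A / 4 + 1 / 2) := by
    intro r hr x hx
    refine (evol_center_sq_le hkn hx r).trans ?_
    rw [← hq]
    have h1 : (1 - 2 * q) ^ (2 * r) ≤ (1 - 2 * q) ^ (2 * t) :=
      pow_le_pow_of_le_one (by linarith) (by linarith) (by omega)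
    have h2 : ((x : ℝ) - n / 2) ^ 2 ≤ n ^ 2 / 4 := by
      have : (x : ℝ) ≤ n := by exact_mod_cast hx
      have : (0 : ℝ) ≤ x := by positivity
      nlinarith
    have h3 : (n : ℝ) / (4 * (1 - q)) ≤ n / 2 := by
      gcongr
      linarith
    have h4 : (1 - 2 * q) ^ (2 * r) * ((x : ℝ) - n / 2) ^ 2 ≤
        (1 - 2 * q) ^ (2 * t) * (n ^ 2 / 4) :=
      mul_le_mul h1 h2 (by positivity) (by rw [pow_mul]; positivity)
    have h5 := mul_le_mul_of_nonneg_left hA (by positivity : (0 : ℝ) ≤ n / 4)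
    nlinarith
  refine distToStationary_le hkn.le fun f hf => ?_
  set h := evol n k s (bulkStep n k f) with hh
  set m : ℕ := n / 2 with hm
  refine ⟨h m, fun x hx => ?_⟩
  have hLip : ∀ y, |h y - h m| ≤ ρ ^ s * (384 / (p * √n)) * |(y : ℝ) - m| := fun y =>
    abs_sub_le_of_abs_succ_sub_le
      (abs_evol_succ_sub_le hk0 hkn.le (abs_bulkStep_succ_sub_le hp0 hpk hn hk hf) s) y m
  -- The AM-GM inequality replaces the first absolute moment by the second one.
  have hdev (y : ℕ) : |(y : ℝ) - m| ≤ (2 * √n)⁻¹ * ((y : ℝ) - n / 2) ^ 2 + 3 / 2 * √n := by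
    have h1 : |(m : ℝ) - n / 2| ≤ 1 := by
      have : (2 : ℝ) * m ≤ n := by exact_mod_cast (by omega : 2 * m ≤ n)
      have : (n : ℝ) ≤ 2 * m + 1 := by exact_mod_cast (by omega : n ≤ 2 * m + 1)
      rw [abs_le]; constructor <;> linarith
    have h2 := abs_sub_le (y : ℝ) (n / 2) m
    rw [abs_sub_comm ((n : ℝ) / 2)] at h2
    have h3 : (2 * √(n : ℝ))⁻¹ * ((y : ℝ) - n / 2) ^ 2 + 1 / 2 * √n - |(y : ℝ) - n / 2| =
        (2 * √(n : ℝ))⁻¹ * (|(y : ℝ) - n / 2| - √n) ^ 2 := by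
      rw [sub_sq |(y : ℝ) - n / 2|, sq_abs]
      field_simp
      ring
    have h4 : 0 ≤ (2 * √(n : ℝ))⁻¹ * (|(y : ℝ) - n / 2| - √n) ^ 2 := by positivity
    linarith
  have b1 : |evol n k t h x - h m| ≤ (A + 2) * (384 / p * ρ ^ s) := by
    have e : evol n k t h x - h m = evol n k t (fun y => h y - h m) x := by
      rw [evol_sub, evol_const hkn.le]
    rw [e]
    refine (abs_evol_le_evol_abs _ _ _ _ hx).trans ?_
    refine (evol_mono (g := fun y => ρ ^ s * (384 / (p * √n)) *
      ((2 * √n)⁻¹ * ((y : ℝ) - n / 2) ^ 2 + 3 / 2 * √n))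
      (fun y _ => (hLip y).trans ?_) x hx).trans ?_
    · exact mul_le_mul_of_nonneg_left (hdev y) (by positivity)
    · rw [evol_const_mul, evol_add, evol_const_mul, evol_const hkn.le]
      have h1 : (2 * √(n : ℝ))⁻¹ * evol n k t (fun y => ((y : ℝ) - n / 2) ^ 2) x ≤
          (2 * √(n : ℝ))⁻¹ * (√n * √n * (A / 4 + 1 / 2)) := by
        rw [hss]
        exact mul_le_mul_of_nonneg_left (hvar t le_rfl x hx) (by positivity)
      have h2 : (2 * √(n : ℝ))⁻¹ * (√n * √n * (A / 4 + 1 / 2)) + 3 / 2 * √n ≤ √n * (A + 2) := by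
        rw [show (2 * √(n : ℝ))⁻¹ * (√n * √n * (A / 4 + 1 / 2)) = √n * (A / 8 + 1 / 4) by
          field_simp; ring]
        nlinarith
      calc _ ≤ ρ ^ s * (384 / (p * √n)) * (√n * (A + 2)) :=
            mul_le_mul_of_nonneg_left (by linarith) (by positivity)
        _ = _ := by field_simp
  have b2 : |evol n k (t + s) (step n k f) x - evol n k (t + s) (bulkStep n k f) x| ≤
      (A + 2) * (8 / n) := by
    rw [← evol_sub]
    refine (abs_evol_le_evol_abs _ _ _ _ hx).trans ?_
    refine (evol_mono (fun y _ => abs_step_sub_bulkStep_le hn hf y) x hx).trans ?_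
    rw [evol_const_mul]
    calc _ ≤ 32 / (n : ℝ) ^ 2 * (n * (A / 4 + 1 / 2)) :=
          mul_le_mul_of_nonneg_left (hvar (t + s) (by omega) x hx) (by positivity)
      _ = _ := by field_simp; ring
  have e : evol n k (t + s + 1) f = evol n k (t + s) (step n k f) := evol_add_apply _ _ _ 1 _
  have e' : evol n k (t + s) (bulkStep n k f) = evol n k t h := evol_add_apply _ _ _ _ _
  rw [e]
  rw [e'] at b2
  have := abs_sub_le (evol n k (t + s) (step n k f) x) (evol n k t h x) (h m)
  linarith

/-- The variance of the stationary distribution, from the invariance of the second moment. -/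
lemma sum_stationary_center_sq_le {n k : ℕ} (hk0 : 0 < k) (hk : 2 * k ≤ n) :
    ∑ x : Fin (n + 1), stationary n x * ((x : ℝ) - n / 2) ^ 2 ≤ (n / 2 : ℝ) := by
  have hn0 : (0 : ℝ) < n := by exact_mod_cast (by omega : 0 < n)
  have hk0' : (0 : ℝ) < k := by exact_mod_cast hk0
  have hk' : (2 : ℝ) * k ≤ n := by exact_mod_cast hk
  set M := ∑ x : Fin (n + 1), stationary n x * ((x : ℝ) - n / 2) ^ 2 with hM
  have h1 : M ≤ (1 - 2 * (k / n : ℝ)) ^ 2 * M + k := by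
    calc M = ∑ x : Fin (n + 1), stationary n x * step n k (fun y => ((y : ℝ) - n / 2) ^ 2) x :=
          (sum_stationary_mul_step (by omega) fun y => ((y : ℝ) - n / 2) ^ 2).symm
      _ ≤ ∑ x : Fin (n + 1), stationary n x *
          ((1 - 2 * (k / n : ℝ)) ^ 2 * ((x : ℝ) - n / 2) ^ 2 + k) :=
        Finset.sum_le_sum fun x _ => mul_le_mul_of_nonneg_left
          (step_center_sq_le (by omega) (by omega) (by omega)) (stationary_nonneg n x)
      _ = _ := by
        simp only [mul_add, Finset.sum_add_distrib, ← Finset.sum_mul, sum_stationary, one_mul]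
        rw [hM, Finset.mul_sum]
        congr 1
        exact Finset.sum_congr rfl fun x _ => by ring
  have hM0 : 0 ≤ M := Finset.sum_nonneg fun x _ =>
    mul_nonneg (stationary_nonneg n x) (by positivity)
  set q : ℝ := k / n with hq
  have hkq : (k : ℝ) = q * n := by rw [hq]; field_simp
  have hq0 : 0 < q := by positivity
  have hq1 : q ≤ 1 / 2 := by rw [hq, div_le_iff₀ hn0]; linarith
  rw [hkq] at h1
  have h2 : q * (4 * (1 - q) * M) ≤ q * n := by nlinarith
  have h3 : 4 * (1 - q) * M ≤ n := le_of_mul_le_mul_left h2 hq0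
  nlinarith [mul_nonneg hM0 (sub_nonneg.mpr hq1)]

/-- Started from `n`, the mean after `t` steps is above `n / 2` by `(1 - 2 k / n) ^ t * n / 2`,
and Chebyshev's inequality separates the chain from stationarity if this is large compared with the
standard deviations, which are of order `√n`. -/
lemma one_sub_le_distToStationary {n k : ℕ} (hk0 : 0 < k) (hk : 2 * k < n) (t : ℕ) :
    1 - 16 / (n * (1 - 2 * (k / n : ℝ)) ^ (2 * t)) ≤ distToStationary n k t := by
  have hn0 : (0 : ℝ) < n := by exact_mod_cast (by omega : 0 < n)
  have hk' : (2 : ℝ) * k < n := by exact_mod_cast hk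
  have hkn : k < n := by omega
  set q : ℝ := k / n with hq
  have hq1 : q < 1 / 2 := by rw [hq, div_lt_iff₀ hn0]; linarith
  set D : ℝ := (1 - 2 * q) ^ t * (n - n / 2) with hD
  have hD0 : 0 < D := mul_pos (pow_pos (by linarith) _) (by linarith)
  have hDsq : D ^ 2 = (1 - 2 * q) ^ (2 * t) * (n - n / 2) ^ 2 := by
    rw [hD, mul_pow, mul_comm 2 t, pow_mul]
  -- The test function of the event that the state exceeds the midpoint of the two means.
  set f : ℕ → ℝ := fun y => if D / 2 ≤ (y : ℝ) - n / 2 then 1 else -1 with hf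
  have hf1 (y : ℕ) : |f y| ≤ 1 := by simp only [hf]; split_ifs <;> simp
  have hlow (y : ℕ) : 1 - 8 / D ^ 2 * ((y : ℝ) - n / 2 - D) ^ 2 ≤ f y := by
    have h0 : 0 ≤ 8 / D ^ 2 * ((y : ℝ) - n / 2 - D) ^ 2 := by positivity
    simp only [hf]
    split_ifs with hy
    · linarith
    · have h1 : (D / 2) ^ 2 ≤ ((y : ℝ) - n / 2 - D) ^ 2 := by nlinarith
      have h2 : 8 / D ^ 2 * (D / 2) ^ 2 ≤ 8 / D ^ 2 * ((y : ℝ) - n / 2 - D) ^ 2 := by gcongr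
      have h3 : 8 / D ^ 2 * (D / 2) ^ 2 = 2 := by field_simp; norm_num
      linarith
  have hup (y : ℕ) : f y ≤ -1 + 8 / D ^ 2 * ((y : ℝ) - n / 2) ^ 2 := by
    have h0 : 0 ≤ 8 / D ^ 2 * ((y : ℝ) - n / 2) ^ 2 := by positivity
    simp only [hf]
    split_ifs with hy
    · have h1 : (D / 2) ^ 2 ≤ ((y : ℝ) - n / 2) ^ 2 := by gcongr
      have h2 : 8 / D ^ 2 * (D / 2) ^ 2 ≤ 8 / D ^ 2 * ((y : ℝ) - n / 2) ^ 2 := by gcongr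
      have h3 : 8 / D ^ 2 * (D / 2) ^ 2 = 2 := by field_simp; norm_num
      linarith
    · linarith
  have b1 : 1 - 8 / D ^ 2 * (n / 2) ≤ evol n k t f n := by
    refine le_trans ?_ (evol_mono (fun y _ => hlow y) n le_rfl)
    rw [evol_sub, evol_const hkn.le, evol_const_mul]
    have e : evol n k t (fun y => ((y : ℝ) - n / 2 - D) ^ 2) n =
        evol n k t (fun y => ((y : ℝ) - n / 2) ^ 2) n +
          (-2 * D * evol n k t (fun y => (y : ℝ) - n / 2) n + D ^ 2) := by
      rw [← evol_const hkn.le t (D ^ 2) n, ← evol_const_mul, ← evol_add, ← evol_add]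
      exact evol_congr (fun y _ => by ring) n le_rfl
    have h1 := evol_center_sq_le hkn le_rfl t
    have h2 : (n : ℝ) / (4 * (1 - q)) ≤ n / 2 := by
      gcongr
      linarith
    have h3 : evol n k t (fun y => ((y : ℝ) - n / 2 - D) ^ 2) n ≤ n / 2 := by
      rw [e, evol_center (by omega) hkn.le le_rfl, ← hq, ← hD]
      rw [← hq, ← hDsq] at h1
      nlinarith
    have := mul_le_mul_of_nonneg_left h3 (by positivity : 0 ≤ 8 / D ^ 2)
    linarith
  have b2 : ∑ z : Fin (n + 1), stationary n z * f z ≤ -1 + 8 / D ^ 2 * (n / 2) := by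
    calc _ ≤ ∑ z : Fin (n + 1), stationary n z * (-1 + 8 / D ^ 2 * ((z : ℝ) - n / 2) ^ 2) :=
          Finset.sum_le_sum fun z _ => mul_le_mul_of_nonneg_left (hup z) (stationary_nonneg n z)
      _ = -1 + 8 / D ^ 2 * ∑ z : Fin (n + 1), stationary n z * ((z : ℝ) - n / 2) ^ 2 := by
        simp only [mul_add, Finset.sum_add_distrib, ← Finset.sum_mul, sum_stationary, one_mul]
        rw [Finset.mul_sum]
        congr 1
        exact Finset.sum_congr rfl fun x _ => by ring
      _ ≤ _ := by
        gcongr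
        exact sum_stationary_center_sq_le hk0 hk.le
  have h := le_distToStationary (n := n) (k := k) (t := t) le_rfl hf1
  have e : 8 / D ^ 2 * ((n : ℝ) / 2) = 16 / (n * (1 - 2 * q) ^ (2 * t)) := by
    have : 0 < (1 - 2 * q) ^ (2 * t) := pow_pos (by linarith) _
    rw [hDsq]
    field_simp
    ring
  rw [← e]
  linarith

/-! ### Asymptotics of the time scales -/

lemma abs_log_one_sub_pos {lam : ℝ} (hlam : lam ∈ Set.Ioo (0 : ℝ) (1 / 2)) :
    0 < |Real.log (1 - 2 * lam)| :=
  abs_pos.mpr (Real.log_neg (by linarith [hlam.2]) (by linarith [hlam.1])).ne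

lemma tendsto_log_natCast_atTop : Tendsto (fun n : ℕ => Real.log n) atTop atTop :=
  Real.tendsto_log_atTop.comp tendsto_natCast_atTop_atTop

lemma tendsto_cutoffTime_atTop {lam : ℝ} (hlam : lam ∈ Set.Ioo (0 : ℝ) (1 / 2)) :
    Tendsto (cutoffTime lam) atTop atTop :=
  tendsto_log_natCast_atTop.atTop_div_const (by have := abs_log_one_sub_pos hlam; positivity)

lemma tendsto_windowSize_atTop {lam : ℝ} (hlam : lam ∈ Set.Ioo (0 : ℝ) (1 / 2)) :
    Tendsto (windowSize lam) atTop atTop :=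
  (Real.tendsto_log_atTop.comp tendsto_log_natCast_atTop).const_mul_atTop (inv_pos.mpr hlam.1)

lemma windowSize_isLittleO_cutoffTime {lam : ℝ} (hlam : lam ∈ Set.Ioo (0 : ℝ) (1 / 2)) :
    windowSize lam =o[atTop] cutoffTime lam := by
  have h1 : (fun n : ℕ => Real.log (Real.log n)) =o[atTop] fun n : ℕ => Real.log n :=
    Real.isLittleO_log_id_atTop.comp_tendsto tendsto_log_natCast_atTop
  have h2 : cutoffTime lam = fun n : ℕ => (2 * |Real.log (1 - 2 * lam)|)⁻¹ * Real.log n :=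
    funext fun n => by rw [cutoffTime, div_eq_inv_mul]
  have h3 := abs_log_one_sub_pos hlam
  rw [h2]
  exact (h1.const_mul_left _).const_mul_right (by positivity)

lemma windowSize_pos {lam : ℝ} (hlam : 0 < lam) {n : ℕ} (hn : 3 ≤ n) : 0 < windowSize lam n := by
  have h3 : (3 : ℝ) ≤ n := by exact_mod_cast hn
  have h1 : 1 < Real.log n := by
    rw [Real.lt_log_iff_exp_lt (by linarith)]
    exact Real.exp_one_lt_three.trans_le h3
  exact mul_pos (inv_pos.mpr hlam) (Real.log_pos h1)

lemma SwapAssumption.bounds {k : ℕ → ℕ} {lam : ℝ} {n₀ : ℕ} (H : SwapAssumption k lam n₀)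
    {n : ℕ} (hn : n₀ ≤ n) : 0 < k n ∧ 2 * k n < n ∧ 3 ≤ n := by
  obtain ⟨δ, hδ, h⟩ := H.bounded
  obtain ⟨h0, h1⟩ := h n hn
  have hn0 : 0 < n := by
    rcases Nat.eq_zero_or_pos n with rfl | h2
    · simp at h0
    · exact h2
  have hk0 : 0 < k n := by
    rcases Nat.eq_zero_or_pos (k n) with h2 | h2
    · simp [h2] at h0
    · exact h2
  have hk : 2 * k n < n := by
    have h2 : (k n : ℝ) / n < 1 / 2 := h1.trans hδ.2
    rw [div_lt_iff₀ (by exact_mod_cast hn0)] at h2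
    have h3 : (2 : ℝ) * k n < n := by linarith
    exact_mod_cast h3
  exact ⟨hk0, hk, by omega⟩

lemma SwapAssumption.eventually_half_le {k : ℕ → ℕ} {lam : ℝ} {n₀ : ℕ}
    (H : SwapAssumption k lam n₀) : ∀ᶠ n in atTop, lam / 2 ≤ (k n : ℝ) / n :=
  H.tendsto.eventually (le_mem_nhds (by linarith [H.lam_mem.1]))

/-- The rate `o(1 / log n)` of convergence of `k / n` to `lam` is what makes
`n (1 - 2 k / n) ^ (2 t_n)` converge to `1`. -/
lemma SwapAssumption.tendsto_log_add {k : ℕ → ℕ} {lam : ℝ} {n₀ : ℕ}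
    (H : SwapAssumption k lam n₀) :
    Tendsto (fun n : ℕ => Real.log n + 2 * cutoffTime lam n * Real.log (1 - 2 * (k n / n : ℝ)))
      atTop (𝓝 0) := by
  have ha := abs_log_one_sub_pos H.lam_mem
  have hneg : Real.log (1 - 2 * lam) < 0 :=
    Real.log_neg (by linarith [H.lam_mem.2]) (by linarith [H.lam_mem.1])
  have hd : DifferentiableAt ℝ (fun x : ℝ => Real.log (1 - 2 * x)) lam := by
    have : 1 - 2 * lam ≠ 0 := by linarith [H.lam_mem.2]
    fun_prop (disch := assumption)
  have h1 := (hd.isBigO_sub.comp_tendsto H.tendsto).trans_isLittleO H.rate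
  have h2 := h1.tendsto_div_nhds_zero.div_const |Real.log (1 - 2 * lam)|
  rw [zero_div] at h2
  refine h2.congr fun n => ?_
  simp only [Function.comp_apply, cutoffTime]
  rw [abs_of_neg hneg] at ha ⊢
  have : Real.log (1 - 2 * lam) ≠ 0 := hneg.ne
  simp only [div_div_eq_mul_div, div_one]
  field_simp
  ring

lemma natCast_mul_pow_eq_exp {n : ℕ} (hn : 0 < n) {q : ℝ} (hq : 0 < q) (t : ℕ) :
    n * q ^ (2 * t) = Real.exp (Real.log n + 2 * t * Real.log q) := by
  rw [Real.exp_add, Real.exp_log (by exact_mod_cast hn), ← Real.exp_log (pow_pos hq (2 * t)),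
    Real.log_pow]
  push_cast
  rfl

/-! ### Bounds on the mixing time -/

/-- At time `t + s + 1` with `t ≈ t_n + s_n` and `s ≈ 2 s_n` the distance to stationarity vanishes
in the limit, by `distToStationary_add_le`. -/
lemma SwapAssumption.eventually_mixingTime_le {k : ℕ → ℕ} {lam : ℝ} {n₀ : ℕ}
    (H : SwapAssumption k lam n₀) {ε : ℝ} (hε : 0 < ε) :
    ∀ᶠ n in atTop, (mixingTime n (k n) ε : ℝ) ≤ cutoffTime lam n + 3 * windowSize lam n + 1 := by
  have hlam := H.lam_mem
  set s : ℕ → ℕ := fun n => ⌊2 * windowSize lam n⌋₊ with hs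
  have hw := tendsto_windowSize_atTop hlam
  have hs' : Tendsto s atTop atTop :=
    tendsto_nat_floor_atTop.comp (hw.const_mul_atTop two_pos)
  have hlim : Tendsto (fun n : ℕ => (2 + 2 : ℝ) *
      (384 / (lam / 2) * (1 - lam / 2) ^ s n + 8 / (n : ℝ))) atTop
      (𝓝 ((2 + 2) * (384 / (lam / 2) * 0 + 0))) := by
    refine Tendsto.const_mul _ (Tendsto.add (Tendsto.const_mul _ ?_) ?_)
    · exact (tendsto_pow_atTop_nhds_zero_of_lt_one (by linarith [hlam.2])
        (by linarith [hlam.1])).comp hs'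
    · exact tendsto_const_nhds.div_atTop tendsto_natCast_atTop_atTop
  simp only [mul_zero, add_zero] at hlim
  filter_upwards [hlim.eventually (gt_mem_nhds hε), eventually_ge_atTop n₀, H.eventually_half_le,
    H.tendsto_log_add.eventually (gt_mem_nhds (Real.log_pos one_lt_two)),
    hw.eventually_ge_atTop 1, (tendsto_cutoffTime_atTop hlam).eventually_ge_atTop 0]
    with n h1 h2 h3 h4 h5 h6
  obtain ⟨hk0, hk, hn3⟩ := H.bounds h2
  have hn0 : (0 : ℝ) < n := by exact_mod_cast (by omega : 0 < n)
  set p : ℝ := k n / n with hp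
  have hp1 : p < 1 / 2 := by
    have : (2 : ℝ) * k n < n := by exact_mod_cast hk
    rw [hp, div_lt_iff₀ hn0]; linarith
  set t : ℕ := ⌊cutoffTime lam n + windowSize lam n⌋₊ with ht
  have ht1 : cutoffTime lam n ≤ t := by
    have := Nat.lt_floor_add_one (cutoffTime lam n + windowSize lam n)
    linarith
  have hpk : lam / 2 * n ≤ k n := by rwa [← le_div_iff₀ hn0]
  have hp0 : 0 < p := by linarith [hlam.1]
  have hA : n * (1 - 2 * p) ^ (2 * t) ≤ 2 := by
    have hl : Real.log (1 - 2 * p) ≤ 0 :=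
      Real.log_nonpos (by linarith) (by linarith)
    rw [natCast_mul_pow_eq_exp (by omega) (by linarith), ← Real.le_log_iff_exp_le two_pos]
    nlinarith
  have hd := distToStationary_add_le (s := s n) (by linarith [hlam.1]) hpk
    (by omega) hk.le hA
  have hρ : ((1 - p) ^ 2 + p ^ 2) ^ s n ≤ (1 - lam / 2) ^ s n := by
    refine pow_le_pow_left₀ (by positivity) ?_ _
    nlinarith
  have hd' : distToStationary n (k n) (t + s n + 1) ≤ ε := by
    refine (hd.trans ?_).trans h1.le
    have : (0 : ℝ) ≤ 384 / (lam / 2) := by have := hlam.1; positivity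
    gcongr
  have hmix : (mixingTime n (k n) ε : ℝ) ≤ ((t + s n + 1 : ℕ) : ℝ) := by
    exact_mod_cast Nat.sInf_le hd'
  have ht2 : (t : ℝ) ≤ cutoffTime lam n + windowSize lam n := Nat.floor_le (by linarith)
  have hs2 : (s n : ℝ) ≤ 2 * windowSize lam n := Nat.floor_le (by linarith)
  push_cast at hmix
  linarith

/-- The width of the window below the cutoff time in which the distance may fall below `ε`. -/
def lowerWindow (lam ε : ℝ) : ℝ := Real.log (33 / (1 - ε)) / (2 * lam)

lemma lowerWindow_pos {lam ε : ℝ} (hlam : 0 < lam) (hε : ε ∈ Set.Ioo (0 : ℝ) 1) :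
    0 < lowerWindow lam ε := by
  refine div_pos (Real.log_pos ?_) (by positivity)
  rw [lt_div_iff₀ (by linarith [hε.2])]
  linarith [hε.1]

lemma SwapAssumption.eventually_le_mixingTime {k : ℕ → ℕ} {lam : ℝ} {n₀ : ℕ}
    (H : SwapAssumption k lam n₀) {ε : ℝ} (hε : ε ∈ Set.Ioo (0 : ℝ) 1) :
    ∀ᶠ n in atTop, cutoffTime lam n - lowerWindow lam ε ≤ (mixingTime n (k n) ε : ℝ) := by
  have hlam := H.lam_mem
  have hε1 : 0 < 1 - ε := by linarith [hε.2]
  filter_upwards [eventually_ge_atTop n₀, H.eventually_half_le,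
    H.tendsto_log_add.eventually (lt_mem_nhds (neg_lt_zero.mpr (Real.log_pos one_lt_two)))]
    with n h2 h3 h4
  obtain ⟨hk0, hk, hn3⟩ := H.bounds h2
  have hn0 : (0 : ℝ) < n := by exact_mod_cast (by omega : 0 < n)
  have hdist := one_sub_le_distToStationary hk0 hk (mixingTime n (k n) ε)
  have hmem : distToStationary n (k n) (mixingTime n (k n) ε) ≤ ε :=
    (isLeast_mixingTime hk0 (by omega) hε.1).1
  by_contra! hlt
  set T := mixingTime n (k n) ε
  set c := lowerWindow lam ε with hc
  have hc0 : 0 < c := lowerWindow_pos hlam.1 hε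
  set p : ℝ := k n / n with hp
  have hp1 : p < 1 / 2 := by
    have : (2 : ℝ) * k n < n := by exact_mod_cast hk
    rw [hp, div_lt_iff₀ hn0]; linarith
  have hl : Real.log (1 - 2 * p) ≤ -lam := by
    have := Real.log_le_sub_one_of_pos (by linarith : 0 < 1 - 2 * p)
    linarith
  have hX : 33 / (1 - ε) / 2 ≤ n * (1 - 2 * p) ^ (2 * T) := by
    rw [natCast_mul_pow_eq_exp (by omega) (by linarith), ← Real.log_le_iff_le_exp (by positivity),
      Real.log_div (by positivity) (by norm_num)]
    have hcl : Real.log (33 / (1 - ε)) = 2 * c * lam := by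
      have := hlam.1
      rw [hc, lowerWindow]; field_simp
    rw [hcl]
    have h5 : (cutoffTime lam n - c - T) * Real.log (1 - 2 * p) ≤ 0 :=
      mul_nonpos_of_nonneg_of_nonpos (by linarith) (by linarith [hlam.1])
    have h6 : c * Real.log (1 - 2 * p) ≤ c * -lam := mul_le_mul_of_nonneg_left hl hc0.le
    linarith
  have h7 : 16 / (n * (1 - 2 * p) ^ (2 * T)) ≤ 16 / (33 / (1 - ε) / 2) :=
    div_le_div_of_nonneg_left (by norm_num) (by positivity) hX
  have h8 : 16 / (33 / (1 - ε) / 2) = 32 / 33 * (1 - ε) := by field_simp; norm_num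
  linarith

lemma SwapAssumption.tendsto_mixingTime_div {k : ℕ → ℕ} {lam : ℝ} {n₀ : ℕ}
    (H : SwapAssumption k lam n₀) {ε : ℝ} (hε : ε ∈ Set.Ioo (0 : ℝ) 1) :
    Tendsto (fun n : ℕ => (mixingTime n (k n) ε : ℝ) / cutoffTime lam n) atTop (𝓝 1) := by
  have ht := tendsto_cutoffTime_atTop H.lam_mem
  have hlow : Tendsto (fun n : ℕ => 1 - lowerWindow lam ε / cutoffTime lam n) atTop
      (𝓝 (1 - 0)) := tendsto_const_nhds.sub (tendsto_const_nhds.div_atTop ht)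
  have hup : Tendsto (fun n : ℕ => 1 + 3 * (windowSize lam n / cutoffTime lam n) +
      1 / cutoffTime lam n) atTop (𝓝 (1 + 3 * 0 + 0)) :=
    (tendsto_const_nhds.add
      ((windowSize_isLittleO_cutoffTime H.lam_mem).tendsto_div_nhds_zero.const_mul 3)).add
      (tendsto_const_nhds.div_atTop ht)
  rw [sub_zero] at hlow
  rw [mul_zero, add_zero, add_zero] at hup
  refine tendsto_of_tendsto_of_tendsto_of_le_of_le' hlow hup ?_ ?_
  · filter_upwards [H.eventually_le_mixingTime hε, ht.eventually_gt_atTop 0] with n h1 h2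
    rw [le_div_iff₀ h2, sub_mul, div_mul_cancel₀ _ h2.ne']
    linarith
  · filter_upwards [H.eventually_mixingTime_le hε.1, ht.eventually_gt_atTop 0] with n h1 h2
    rw [div_le_iff₀ h2, add_mul, add_mul, mul_assoc, div_mul_cancel₀ _ h2.ne',
      div_mul_cancel₀ _ h2.ne']
    linarith

lemma SwapAssumption.hasCutoff {k : ℕ → ℕ} {lam : ℝ} {n₀ : ℕ} (H : SwapAssumption k lam n₀) :
    HasCutoff fun n ε => mixingTime n (k n) ε := by
  intro ε hε
  have hε' : 1 - ε ∈ Set.Ioo (0 : ℝ) 1 := ⟨by linarith [hε.2], by linarith [hε.1]⟩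
  have h := (H.tendsto_mixingTime_div hε).div (H.tendsto_mixingTime_div hε') one_ne_zero
  rw [div_one] at h
  refine h.congr' ?_
  filter_upwards [(tendsto_cutoffTime_atTop H.lam_mem).eventually_gt_atTop 0] with n hn
  exact div_div_div_cancel_right₀ hn.ne' _ _

lemma SwapAssumption.windowSize_isLittleO_mixingTime {k : ℕ → ℕ} {lam : ℝ} {n₀ : ℕ}
    (H : SwapAssumption k lam n₀) {ε : ℝ} (hε : ε ∈ Set.Ioo (0 : ℝ) 1) :
    windowSize lam =o[atTop] fun n => (mixingTime n (k n) ε : ℝ) :=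
  (windowSize_isLittleO_cutoffTime H.lam_mem).trans_isBigO
    (isEquivalent_of_tendsto_one (H.tendsto_mixingTime_div hε)).symm.isBigO

lemma SwapAssumption.exists_mixingTime_sub_le {k : ℕ → ℕ} {lam : ℝ} {n₀ : ℕ}
    (H : SwapAssumption k lam n₀) {ε : ℝ} (hε : ε ∈ Set.Ioo (0 : ℝ) 1) :
    ∃ C : ℝ, ∀ n ≥ n₀, (mixingTime n (k n) ε : ℝ) - (mixingTime n (k n) (1 - ε) : ℝ) ≤
      C * windowSize lam n := by
  have hε' : 1 - ε ∈ Set.Ioo (0 : ℝ) 1 := ⟨by linarith [hε.2], by linarith [hε.1]⟩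
  set c := lowerWindow lam (1 - ε) with hc
  have hc0 : 0 < c := lowerWindow_pos H.lam_mem.1 hε'
  set D : ℕ → ℝ := fun n => (mixingTime n (k n) ε : ℝ) - (mixingTime n (k n) (1 - ε) : ℝ)
  have hev : ∀ᶠ n in atTop, D n ≤ (4 + c) * windowSize lam n := by
    filter_upwards [H.eventually_mixingTime_le hε.1, H.eventually_le_mixingTime hε',
      (tendsto_windowSize_atTop H.lam_mem).eventually_ge_atTop 1] with n h1 h2 h3
    simp only [D]
    nlinarith
  obtain ⟨N, hN⟩ := eventually_atTop.mp hev
  -- The finitely many `n` below `N` are absorbed into the constant, as the window is positive.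
  refine ⟨(4 + c) + ∑ m ∈ Finset.range N, |D m / windowSize lam m|, fun n hn => ?_⟩
  have hw := windowSize_pos H.lam_mem.1 (H.bounds hn).2.2
  change D n ≤ _
  rcases le_or_gt N n with h | h
  · refine (hN n h).trans (mul_le_mul_of_nonneg_right ?_ hw.le)
    exact le_add_of_nonneg_right (Finset.sum_nonneg fun _ _ => abs_nonneg _)
  · rw [← div_le_iff₀ hw]
    have h1 := Finset.single_le_sum (f := fun m => |D m / windowSize lam m|)
      (fun _ _ => abs_nonneg _) (Finset.mem_range.mpr h)
    have h2 := le_abs_self (D n / windowSize lam n)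
    linarith

end BernoulliLaplace

end

theorem theorem1 (lam : ℝ) (hlam : lam ∈ Set.Ioo (0 : ℝ) (1 / 2)) :
    (∀ ε ∈ Set.Ioo (0 : ℝ) 1, ∃ c : ℝ, 0 < c ∧
      ∀ (k : ℕ → ℕ) (n₀ : ℕ), BernoulliLaplace.SwapAssumption k lam n₀ →
        ∃ N : ℕ, 0 < N ∧ ∀ n ≥ N,
          BernoulliLaplace.cutoffTime lam n - c ≤ (BernoulliLaplace.mixingTime n (k n) ε : ℝ) ∧
          (BernoulliLaplace.mixingTime n (k n) ε : ℝ) ≤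
            BernoulliLaplace.cutoffTime lam n + 3 * BernoulliLaplace.windowSize lam n + 1) ∧
    (∀ (k : ℕ → ℕ) (n₀ : ℕ), BernoulliLaplace.SwapAssumption k lam n₀ →
      -- the minimum in the definition of the mixing time is over a nonempty set
      (∀ ε ∈ Set.Ioo (0 : ℝ) 1, ∀ n ≥ n₀,
        IsLeast {t : ℕ | BernoulliLaplace.distToStationary n (k n) t ≤ ε}
          (BernoulliLaplace.mixingTime n (k n) ε)) ∧
      -- cutoff at time `t_n`
      (∀ ε ∈ Set.Ioo (0 : ℝ) 1,
        Tendsto (fun n : ℕ => (BernoulliLaplace.mixingTime n (k n) ε : ℝ) /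
          BernoulliLaplace.cutoffTime lam n) atTop (𝓝 1)) ∧
      -- with window `s_n`
      BernoulliLaplace.HasCutoffWindow n₀
        (fun n ε => BernoulliLaplace.mixingTime n (k n) ε)
        (BernoulliLaplace.windowSize lam)) := by
  refine ⟨fun ε hε => ⟨BernoulliLaplace.lowerWindow lam ε,
    BernoulliLaplace.lowerWindow_pos hlam.1 hε, fun k n₀ H => ?_⟩, fun k n₀ H =>
    ⟨fun ε hε n hn => ?_, fun ε hε => H.tendsto_mixingTime_div hε, H.hasCutoff,
      H.windowSize_isLittleO_mixingTime (by norm_num), fun ε hε => H.exists_mixingTime_sub_le hε⟩⟩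
  · obtain ⟨N, hN⟩ := eventually_atTop.mp
      ((H.eventually_le_mixingTime hε).and (H.eventually_mixingTime_le hε.1))
    exact ⟨N + 1, N.succ_pos, fun n hn => hN n (by omega)⟩
  · obtain ⟨hk0, hk, -⟩ := H.bounds hn
    exact BernoulliLaplace.isLeast_mixingTime hk0 (by omega) hε.1
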